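/- Let $R$ be a discrete valuation ring with uniformizer $\varpi$ and fraction field $K$. For an $R$-module $N$ write $N_{\mathrm{tors}}$ for its torsion submodule and $N_{\mathrm{tf}}=N/N_{\mathrm{tors}}$. Let $M$ be a spectrum with a decreasing filtration $\cdots\to \mathrm{fil}^{n+1}M\to \mathrm{fil}^nM\to\cdots\to M$ $(n\in\mathbb Z)$, and put $\mathrm{gr}^nM=\mathrm{cofib}(\mathrm{fil}^{n+1}M\to\mathrm{fil}^nM)$. Assume: - the filtration is complete ($\lim_n \mathrm{fil}^nM\simeq 0$) and exhaustive ($\mathrm{colim}_{n\to-\infty}\mathrm{fil}^nM\simeq M$); - all $\pi_i(M)$, $\pi_i(\mathrm{fil}^nM)$, $\pi_i(\mathrm{gr}^nM)$ are finitely generated $R$-modules, and all maps of the exact couple, as well as the maps $\pi_i(\mathrm{fil}^nM)\to\pi_i(M)$, are $R$-linear; - the spectral sequence $E_1^{n,i}=\pi_i(\mathrm{gr}^nM)\Rightarrow\pi_i(M)$ with differentials $d_r:E_r^{n,i}\to E_r^{n+r,i-1}$ is strongly convergent: the filtration $F^n\pi_i(M)=\mathrm{im}(\pi_i(\mathrm{fil}^nM)\to\pi_i(M))$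 is exhaustive, Hausdorff and complete, and $F^n\pi_i(M)/F^{n+1}\pi_i(M)\cong E_\infty^{n,i}$ canonically; - it is locally finite: for every $i$, one has $F^n\pi_i(M)\neq F^{n+1}\pi_i(M)$ for only finitely many $n$; - it degenerates rationally: $d_r\otimes_RK=0$ for all $r\ge 1$. Call $M$ *degenerate* if $\pi_i(\mathrm{fil}^nM)\to\pi_i(M)$ is injective for all $i,n$; *saturated degenerate* if it is degenerate and for all $i,n$ the induced injection $\pi_i(\mathrm{fil}^nM)_{\mathrm{tf}}\to\pi_i(M)_{\mathrm{tf}}$ is saturated, where an inclusion $A\subset B$ is saturated if $\varpi A=A\cap\varpi B$; *split degenerate* if it is degenerate and every injection $\pi_i(\mathrm{fil}^nM)\to\pi_i(M)$ splits $R$-linearly. Then: 1. $M$ is saturated degenerate if and only if, for every $i\in\mathbb Z$, $$\mathrm{length}_R\bigl(\pi_i(M)_{\mathrm{tors}}\bigr)=\sum_{n\in\mathbb Z}\mathrm{length}_R\bigl(\pi_i(\mathrm{gr}^nM)_{\mathrm{tors}}\bigr)$$ (the sum being taken in $\mathbb N\cup\{\infty\}$). 2. $M$ is split degenerate if and only if,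 for every $i\in\mathbb Z$, there is an abstract isomorphism of $R$-modules $$\pi_i(M)_{\mathrm{tors}}\cong\bigoplus_{n\in\mathbb Z}\pi_i(\mathrm{gr}^nM)_{\mathrm{tors}}.$$ -/

import Mathlib

open CategoryTheory Topology TensorProduct DirectSum
open scoped unitInterval Topology.Homotopy

noncomputable section

universe u v

/-! ### Functoriality of homotopy groups -/

namespace HomotopyGroup

variable {N : Type} {X Y Z : Type*} [TopologicalSpace X] [TopologicalSpace Y] [TopologicalSpace Z]

/-- Composition of a generalized loop with a pointed continuous map. -/
def pushLoop (f : C(X, Y)) {x : X} {y : Y} (h : f x = y) (p : Ω^ N X x) : Ω^ N Y y :=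
  ⟨f.comp p.1, fun t ht => by
    have := p.2 t ht
    simp only [ContinuousMap.comp_apply]
    rw [this, h]⟩

/-- The map induced on homotopy groups by a pointed continuous map. -/
def map (f : C(X, Y)) {x : X} {y : Y} (h : f x = y) :
    HomotopyGroup N X x → HomotopyGroup N Y y :=
  Quotient.map' (pushLoop f h) fun _ _ H => H.map fun K => K.compContinuousMap f

theorem pushLoop_transAt [DecidableEq N] (f : C(X, Y)) {x : X} {y : Y} (h : f x = y) (i : N)
    (p q : Ω^ N X x) :
    pushLoop f h (GenLoop.transAt i p q)
      = GenLoop.transAt i (pushLoop f h p) (pushLoop f h q) := by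
  ext t
  change f (GenLoop.transAt i p q t) = _
  simp only [GenLoop.transAt, GenLoop.coe_copy]
  split_ifs <;> rfl

/-- The homomorphism induced on homotopy groups by a pointed continuous map. -/
def mapHom [DecidableEq N] [Nonempty N] (f : C(X, Y)) {x : X} {y : Y} (h : f x = y) :
    HomotopyGroup N X x →* HomotopyGroup N Y y :=
  MonoidHom.mk' (map f h) fun a b => by
    induction a using Quotient.inductionOn with | _ p
    induction b using Quotient.inductionOn with | _ q
    have i : N := Classical.arbitrary N
    refine (congrArg (map f h) (mul_spec (i := i) (p := p) (q := q))).trans ?_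
    refine Eq.trans ?_ (mul_spec (i := i) (p := pushLoop f h p) (q := pushLoop f h q)).symm
    exact congrArg (Quotient.mk _) (pushLoop_transAt f h i q p)

end HomotopyGroup

/-- A weak homotopy equivalence: a continuous map inducing bijections on `π_n` for all `n ≥ 0`
and all base points (`π_0` is the set of path components). -/
def IsWeakHomotopyEquiv {X Y : Type*} [TopologicalSpace X] [TopologicalSpace Y] (f : C(X, Y)) :
    Prop :=
  (Nonempty Y → Nonempty X) ∧
    ∀ (n : ℕ) (x : X), Function.Bijective
      (HomotopyGroup.map (N := Fin n) f (rfl : f x = f x))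

/-! ### Spectra -/

/-- A sequential prespectrum, indexed by `ℤ`: pointed spaces `X_k` with pointed maps
`X_k → Ω X_{k+1}`. -/
structure Prespectrum where
  space : ℤ → Type u
  [top : ∀ k, TopologicalSpace (space k)]
  pt : ∀ k, space k
  str : ∀ k, C(space k, Ω (space (k + 1)) (pt (k + 1)))
  str_pt : ∀ k, str k (pt k) = Path.refl _

namespace Prespectrum

attribute [instance] Prespectrum.top

/-- An `Ω`-spectrum: all structure maps `X_k → Ω X_{k+1}` are weak homotopy equivalences.
As the index `k` runs over `ℤ`, the negative levels are `X_{-k} ≃ Ω^k X_0` and carry no further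
information. `Ω`-spectra are the model of spectra used here. -/
def IsOmega (X : Prespectrum.{u}) : Prop := ∀ k, IsWeakHomotopyEquiv (X.str k)

/-- Maps of prespectra: pointed maps strictly compatible with the structure maps. -/
@[ext]
structure Hom (X Y : Prespectrum.{u}) where
  app : ∀ k, C(X.space k, Y.space k)
  app_pt : ∀ k, app k (X.pt k) = Y.pt k
  app_str : ∀ k x t, Y.str k (app k x) t = app (k + 1) (X.str k x t)

instance : Category Prespectrum.{u} where
  Hom := Hom
  id X := ⟨fun _ => ContinuousMap.id _, fun _ => rfl, fun _ _ _ => rfl⟩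
  comp f g := ⟨fun k => (g.app k).comp (f.app k),
    fun k => by simp [f.app_pt, g.app_pt], fun k x t => by simp [f.app_str, g.app_str]⟩

/-- The homotopy group `π_i(X)`, `i ∈ ℤ`, of an `Ω`-spectrum. In an `Ω`-spectrum all the groups
`π_{i+k}(X_k)` are identified by the structure maps; `π_2(X_{2-i})` is used as the representative,
so that the group is visibly abelian. It is written additively. -/
def π (X : Prespectrum.{u}) (i : ℤ) : Type u :=
  Additive (HomotopyGroup (Fin 2) (X.space (2 - i)) (X.pt (2 - i)))

instance (X : Prespectrum.{u}) (i : ℤ) : AddCommGroup (X.π i) :=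
  inferInstanceAs
    (AddCommGroup (Additive (HomotopyGroup (Fin 2) (X.space (2 - i)) (X.pt (2 - i)))))

/-- The homomorphism on `π_i` induced by a pointed map defined on level `2 - i`. -/
def πLevelMap {X Y : Prespectrum.{u}} {i j : ℤ} (f : C(X.space (2 - i), Y.space (2 - j)))
    (h : f (X.pt (2 - i)) = Y.pt (2 - j)) : X.π i →+ Y.π j :=
  MonoidHom.toAdditive (HomotopyGroup.mapHom (N := Fin 2) f h)

/-- The homomorphism `π_i(X) → π_i(Y)` induced by a map of spectra. -/
def πMap {X Y : Prespectrum.{u}} (f : X ⟶ Y) (i : ℤ) : X.π i →+ Y.π i :=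
  πLevelMap (Hom.app f (2 - i)) (Hom.app_pt f (2 - i))

theorem πMap_id (X : Prespectrum.{u}) (i : ℤ) (x : X.π i) : πMap (𝟙 X) i x = x := by
  change HomotopyGroup (Fin 2) (X.space (2 - i)) (X.pt (2 - i)) at x
  induction x using Quotient.inductionOn with | _ p
  rfl

theorem πMap_comp {X Y Z : Prespectrum.{u}} (f : X ⟶ Y) (g : Y ⟶ Z) (i : ℤ) (x : X.π i) :
    πMap (f ≫ g) i x = πMap g i (πMap f i x) := by
  change HomotopyGroup (Fin 2) (X.space (2 - i)) (X.pt (2 - i)) at x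
  induction x using Quotient.inductionOn with | _ p
  rfl

/-! ### The cofibre of a map of spectra -/

/-- The homotopy fibre of `f_k : X_k → Y_k`: pairs of a point `x` and a path from the base point
to `f_k(x)`. -/
def HoFib {X Y : Prespectrum.{u}} (f : X ⟶ Y) (k : ℤ) : Type u :=
  {p : X.space k × C(I, Y.space k) // p.2 0 = Y.pt k ∧ p.2 1 = Hom.app f k p.1}

instance {X Y : Prespectrum.{u}} (f : X ⟶ Y) (k : ℤ) : TopologicalSpace (HoFib f k) :=
  inferInstanceAs (TopologicalSpace {p : X.space k × C(I, Y.space k) //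
    p.2 0 = Y.pt k ∧ p.2 1 = Hom.app f k p.1})

/-- The base point of the homotopy fibre. -/
def HoFib.pt {X Y : Prespectrum.{u}} (f : X ⟶ Y) (k : ℤ) : HoFib f k :=
  ⟨(X.pt k, ContinuousMap.const _ (Y.pt k)), rfl, (Hom.app_pt f k).symm⟩

/-- The structure map `hofib(f_k) → Ω hofib(f_{k+1})`, sending `(x, γ)` to the loop
`t ↦ (σ(x)(t), s ↦ σ(γ(s))(t))`, where `σ` denotes the structure maps of `X` and `Y`. -/
def HoFib.str {X Y : Prespectrum.{u}} (f : X ⟶ Y) (k : ℤ) :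
    C(HoFib f k, Ω (HoFib f (k + 1)) (HoFib.pt f (k + 1))) where
  toFun p :=
    { toFun := fun t => ⟨(X.str k p.1.1 t,
        ⟨fun s => Y.str k (p.1.2 s) t, by fun_prop⟩),
        by simp [p.2.1, Y.str_pt], by simp [p.2.2, Hom.app_str]⟩
      continuous_toFun := by
        refine Continuous.subtype_mk (Continuous.prodMk (by fun_prop) ?_) _
        refine ContinuousMap.continuous_of_continuous_uncurry _ ?_
        change Continuous fun q : I × I => Y.str k (p.1.2 q.2) q.1
        fun_prop
      source' := Subtype.ext (Prod.ext (by simp [HoFib.pt]) (by ext; simp [HoFib.pt]))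
      target' := Subtype.ext (Prod.ext (by simp [HoFib.pt]) (by ext; simp [HoFib.pt])) }
  continuous_toFun := by
    refine Path.continuous_uncurry_iff.1 ?_
    refine Continuous.subtype_mk (Continuous.prodMk ?_ ?_) _
    · change Continuous fun q : HoFib f k × I => X.str k q.1.1.1 q.2
      have : Continuous fun q : HoFib f k × I => q.1.1.1 := by
        exact continuous_fst.comp (continuous_subtype_val.comp continuous_fst)
      fun_prop
    · refine ContinuousMap.continuous_of_continuous_uncurry _ ?_
      change Continuous fun q : (HoFib f k × I) × I => Y.str k (q.1.1.1.2 q.2) q.1.2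
      have : Continuous fun q : (HoFib f k × I) × I => q.1.1.1.2 := by
        exact continuous_snd.comp
          (continuous_subtype_val.comp (continuous_fst.comp continuous_fst))
      fun_prop

/-- The cofibre of a map of `Ω`-spectra. In the stable setting `cofib(f) ≃ Σ fib(f)`; the fibre
is computed levelwise and `Σ` shifts the levels by one, so `cofib(f)_k = hofib(f_{k+1})`. -/
def cofib {X Y : Prespectrum.{u}} (f : X ⟶ Y) : Prespectrum.{u} where
  space k := HoFib f (k + 1)
  pt k := HoFib.pt f (k + 1)
  str k := HoFib.str f (k + 1)
  str_pt k := by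
    ext t
    refine Subtype.ext (Prod.ext ?_ ?_)
    · change X.str (k + 1) (X.pt (k + 1)) t = X.pt (k + 1 + 1)
      rw [X.str_pt, Path.refl_apply]
    · ext s
      change Y.str (k + 1) (Y.pt (k + 1)) t = Y.pt (k + 1 + 1)
      rw [Y.str_pt, Path.refl_apply]

/-- The pointed map `Y_k ≃ Ω Y_{k+1} → hofib(f_{k+1}) = cofib(f)_k`. -/
def toCofibLevel {X Y : Prespectrum.{u}} (f : X ⟶ Y) (k : ℤ) :
    C(Y.space k, (cofib f).space k) where
  toFun y := ⟨(X.pt (k + 1), (Y.str k y).toContinuousMap),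
    (Y.str k y).source, (Y.str k y).target.trans (Hom.app_pt f (k + 1)).symm⟩
  continuous_toFun := by
    refine Continuous.subtype_mk (Continuous.prodMk continuous_const ?_) _
    exact continuous_induced_dom.comp (Y.str k).continuous

/-- The map `π_i(Y) → π_i(cofib f)`. -/
def πToCofib {X Y : Prespectrum.{u}} (f : X ⟶ Y) (i : ℤ) : Y.π i →+ (cofib f).π i :=
  πLevelMap (toCofibLevel f (2 - i)) <| by
    refine Subtype.ext (Prod.ext rfl ?_)
    ext s
    change Y.str (2 - i) (Y.pt (2 - i)) s = Y.pt (2 - i + 1)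
    rw [Y.str_pt, Path.refl_apply]

/-- The identification of two levels of a prespectrum with equal indices. -/
def levelCast (X : Prespectrum.{u}) {a b : ℤ} (h : a = b) : C(X.space a, X.space b) :=
  h ▸ ContinuousMap.id _

theorem levelCast_pt (X : Prespectrum.{u}) {a b : ℤ} (h : a = b) :
    X.levelCast h (X.pt a) = X.pt b := by
  subst h; rfl

/-- The projection `cofib(f)_k = hofib(f_{k+1}) → X_{k+1}` for `k = 2 - i`, where
`k + 1 = 2 - (i - 1)`. -/
def boundaryLevel {X Y : Prespectrum.{u}} (f : X ⟶ Y) (i : ℤ) :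
    C((cofib f).space (2 - i), X.space (2 - (i - 1))) :=
  (X.levelCast (by ring : (2 - i) + 1 = 2 - (i - 1))).comp
    ⟨fun p : HoFib f ((2 - i) + 1) => p.1.1, continuous_fst.comp continuous_subtype_val⟩

/-- The boundary map `π_i(cofib f) → π_{i-1}(X)`. -/
def πBoundary {X Y : Prespectrum.{u}} (f : X ⟶ Y) (i : ℤ) : (cofib f).π i →+ X.π (i - 1) :=
  πLevelMap (boundaryLevel f i) (X.levelCast_pt _)

theorem πBoundary_πToCofib {X Y : Prespectrum.{u}} (f : X ⟶ Y) (i : ℤ) (y : Y.π i) :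
    πBoundary f i (πToCofib f i y) = 0 := by
  change HomotopyGroup (Fin 2) (Y.space (2 - i)) (Y.pt (2 - i)) at y
  induction y using Quotient.inductionOn with | _ p
  change (⟦_⟧ : HomotopyGroup (Fin 2) (X.space (2 - (i - 1))) (X.pt (2 - (i - 1)))) = ⟦_⟧
  congr 1
  ext t
  exact X.levelCast_pt _

/-! ### The homotopy limit of a tower of spectra -/

/-- Level `k` of the homotopy limit of `⋯ → F(n+1) → F(n) → F(n-1) → ⋯`: families of points
`x_n ∈ F(n)_k` with paths from `x_n` to the image of `x_{n+1}`. -/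
def HoLim (F : ℤᵒᵖ ⥤ Prespectrum.{u}) (k : ℤ) : Type u :=
  {p : (∀ n : ℤ, (F.obj (.op n)).space k) × (∀ n : ℤ, C(I, (F.obj (.op n)).space k)) //
    ∀ n : ℤ, p.2 n 0 = p.1 n ∧
      p.2 n 1 = Hom.app (F.map (homOfLE (by lia : n ≤ n + 1)).op) k (p.1 (n + 1))}

instance (F : ℤᵒᵖ ⥤ Prespectrum.{u}) (k : ℤ) : TopologicalSpace (HoLim F k) :=
  inferInstanceAs (TopologicalSpace
    {p : (∀ n : ℤ, (F.obj (.op n)).space k) × (∀ n : ℤ, C(I, (F.obj (.op n)).space k)) //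
      ∀ n : ℤ, p.2 n 0 = p.1 n ∧
        p.2 n 1 = Hom.app (F.map (homOfLE (by lia : n ≤ n + 1)).op) k (p.1 (n + 1))})

/-- The base point of the homotopy limit. -/
def HoLim.pt (F : ℤᵒᵖ ⥤ Prespectrum.{u}) (k : ℤ) : HoLim F k :=
  ⟨(fun n => (F.obj (.op n)).pt k, fun n => ContinuousMap.const _ ((F.obj (.op n)).pt k)),
    fun _ => ⟨rfl, (Hom.app_pt _ k).symm⟩⟩

/-- The structure maps of the homotopy limit, induced by those of the terms of the tower. -/
def HoLim.str (F : ℤᵒᵖ ⥤ Prespectrum.{u}) (k : ℤ) :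
    C(HoLim F k, Ω (HoLim F (k + 1)) (HoLim.pt F (k + 1))) where
  toFun p :=
    { toFun := fun t => ⟨(fun n => (F.obj (.op n)).str k (p.1.1 n) t,
        fun n => ⟨fun s => (F.obj (.op n)).str k (p.1.2 n s) t, by fun_prop⟩),
        fun n => ⟨by simp [(p.2 n).1], by simp [(p.2 n).2, Hom.app_str]⟩⟩
      continuous_toFun := by
        refine Continuous.subtype_mk (Continuous.prodMk (by fun_prop) ?_) _
        refine continuous_pi fun n => ContinuousMap.continuous_of_continuous_uncurry _ ?_
        change Continuous fun q : I × I => (F.obj (.op n)).str k (p.1.2 n q.2) q.1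
        fun_prop
      source' := Subtype.ext (Prod.ext (by ext; simp [HoLim.pt]) (by ext; simp [HoLim.pt]))
      target' := Subtype.ext (Prod.ext (by ext; simp [HoLim.pt]) (by ext; simp [HoLim.pt])) }
  continuous_toFun := by
    refine Path.continuous_uncurry_iff.1 ?_
    refine Continuous.subtype_mk (Continuous.prodMk ?_ ?_) _
    · refine continuous_pi fun n => ?_
      change Continuous fun q : HoLim F k × I => (F.obj (.op n)).str k (q.1.1.1 n) q.2
      have : Continuous fun q : HoLim F k × I => q.1.1.1 n :=
        (continuous_apply n).comp
          (continuous_fst.comp (continuous_subtype_val.comp continuous_fst))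
      fun_prop
    · refine continuous_pi fun n => ContinuousMap.continuous_of_continuous_uncurry _ ?_
      change Continuous fun q : (HoLim F k × I) × I =>
        (F.obj (.op n)).str k (q.1.1.1.2 n q.2) q.1.2
      have : Continuous fun q : (HoLim F k × I) × I => q.1.1.1.2 n :=
        (continuous_apply n).comp (continuous_snd.comp
          (continuous_subtype_val.comp (continuous_fst.comp continuous_fst)))
      fun_prop

/-- The homotopy limit of a tower of `Ω`-spectra, computed levelwise. -/
def holim (F : ℤᵒᵖ ⥤ Prespectrum.{u}) : Prespectrum.{u} where
  space k := HoLim F k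
  pt k := HoLim.pt F k
  str k := HoLim.str F k
  str_pt k := by
    ext t
    refine Subtype.ext (Prod.ext ?_ ?_)
    · ext n
      change (F.obj (.op n)).str k ((F.obj (.op n)).pt k) t = (F.obj (.op n)).pt (k + 1)
      rw [Prespectrum.str_pt, Path.refl_apply]
    · ext n s
      change (F.obj (.op n)).str k ((F.obj (.op n)).pt k) t = (F.obj (.op n)).pt (k + 1)
      rw [Prespectrum.str_pt, Path.refl_apply]

end Prespectrum

/-! ### Filtered spectra -/

open Prespectrum in
/-- A spectrum `M` with a decreasing filtration
`⋯ → fil^{n+1} M → fil^n M → fil^{n-1} M → ⋯ → M`. -/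
structure FilteredSpectrum where
  fil : ℤᵒᵖ ⥤ Prespectrum.{u}
  total : Prespectrum.{u}
  toTotal : fil ⟶ (Functor.const ℤᵒᵖ).obj total
  isOmega_fil : ∀ n : ℤ, (fil.obj (.op n)).IsOmega
  isOmega_total : total.IsOmega

namespace FilteredSpectrum

open Prespectrum

variable (M : FilteredSpectrum.{u})

/-- The transition map `fil^m M → fil^n M` for `n ≤ m`. -/
def tr {n m : ℤ} (h : n ≤ m) : M.fil.obj (.op m) ⟶ M.fil.obj (.op n) :=
  M.fil.map (homOfLE h).op

/-- The graded piece `gr^n M = cofib(fil^{n+1} M → fil^n M)`. -/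
def gr (n : ℤ) : Prespectrum.{u} := cofib (M.tr (by lia : n ≤ n + 1))

/-- `π_i(M)`. -/
def πTot (i : ℤ) : Type u := M.total.π i

/-- `π_i(fil^n M)`. -/
def πFil (n i : ℤ) : Type u := (M.fil.obj (.op n)).π i

/-- `π_i(gr^n M)`. -/
def πGr (n i : ℤ) : Type u := (M.gr n).π i

instance (i : ℤ) : AddCommGroup (M.πTot i) := inferInstanceAs (AddCommGroup (M.total.π i))

instance (n i : ℤ) : AddCommGroup (M.πFil n i) :=
  inferInstanceAs (AddCommGroup ((M.fil.obj (.op n)).π i))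

instance (n i : ℤ) : AddCommGroup (M.πGr n i) := inferInstanceAs (AddCommGroup ((M.gr n).π i))

/-- The map `π_i(fil^m M) → π_i(fil^n M)` for `n ≤ m`. -/
def trHom {n m : ℤ} (h : n ≤ m) (i : ℤ) : M.πFil m i →+ M.πFil n i := πMap (M.tr h) i

/-- The map `π_i(fil^n M) → π_i(M)`. -/
def totHom (n i : ℤ) : M.πFil n i →+ M.πTot i := πMap (M.toTotal.app (.op n)) i

/-- The map `π_i(fil^n M) → π_i(gr^n M)`. -/
def grHom (n i : ℤ) : M.πFil n i →+ M.πGr n i := πToCofib (M.tr (by lia : n ≤ n + 1)) i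

/-- The boundary map `π_i(gr^n M) → π_{i-1}(fil^{n+1} M)`. -/
def bdHom (n i : ℤ) : M.πGr n i →+ M.πFil (n + 1) (i - 1) :=
  πBoundary (M.tr (by lia : n ≤ n + 1)) i

/-- The filtration is complete: `lim_n fil^n M ≃ 0`. -/
def IsComplete : Prop := ∀ i, Subsingleton ((holim M.fil).π i)

/-- The filtration is exhaustive: `colim_n fil^n M ≃ M`, the colimit being taken for `n → -∞`.
As homotopy groups commute with sequential colimits, this says that the map
`colim_n π_i(fil^n M) → π_i(M)` is bijective for all `i`; surjectivity and injectivity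
are spelled out. -/
def IsExhaustive : Prop :=
  (∀ (i : ℤ) (x : M.πTot i), ∃ (n : ℤ) (y : M.πFil n i), M.totHom n i y = x) ∧
  (∀ (n i : ℤ) (y : M.πFil n i), M.totHom n i y = 0 →
    ∃ (m : ℤ) (h : m ≤ n), M.trHom h i y = 0)

/-- `R`-module structures on all the groups `π_i(M)`, `π_i(fil^n M)`, `π_i(gr^n M)` for which the
maps of the exact couple, and the maps `π_i(fil^n M) → π_i(M)`, are `R`-linear. -/
class LinearStructure (R : Type v) [CommRing R] where
  modTot : ∀ i, Module R (M.πTot i)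
  modFil : ∀ n i, Module R (M.πFil n i)
  modGr : ∀ n i, Module R (M.πGr n i)
  tr_smul : ∀ {n m : ℤ} (h : n ≤ m) (i : ℤ) (r : R) (x : M.πFil m i),
    M.trHom h i (r • x) = r • M.trHom h i x
  tot_smul : ∀ (n i : ℤ) (r : R) (x : M.πFil n i), M.totHom n i (r • x) = r • M.totHom n i x
  gr_smul : ∀ (n i : ℤ) (r : R) (x : M.πFil n i), M.grHom n i (r • x) = r • M.grHom n i x
  bd_smul : ∀ (n i : ℤ) (r : R) (x : M.πGr n i), M.bdHom n i (r • x) = r • M.bdHom n i x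

attribute [reducible] LinearStructure.modTot LinearStructure.modFil LinearStructure.modGr
attribute [instance] LinearStructure.modTot LinearStructure.modFil LinearStructure.modGr

section Linear

variable (R : Type v) [CommRing R] [M.LinearStructure R]

/-- All the groups `π_i(M)`, `π_i(fil^n M)`, `π_i(gr^n M)` are finitely generated over `R`. -/
structure HasFiniteHomotopy : Prop where
  tot : ∀ i, Module.Finite R (M.πTot i)
  fil : ∀ n i, Module.Finite R (M.πFil n i)
  gr : ∀ n i, Module.Finite R (M.πGr n i)

/-- `π_i(fil^m M) → π_i(fil^n M)` as an `R`-linear map. -/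
def trLin {n m : ℤ} (h : n ≤ m) (i : ℤ) : M.πFil m i →ₗ[R] M.πFil n i :=
  { M.trHom h i with map_smul' := LinearStructure.tr_smul h i }

/-- `π_i(fil^n M) → π_i(M)` as an `R`-linear map. -/
def totLin (n i : ℤ) : M.πFil n i →ₗ[R] M.πTot i :=
  { M.totHom n i with map_smul' := LinearStructure.tot_smul n i }

/-- `π_i(fil^n M) → π_i(gr^n M)` as an `R`-linear map. -/
def grLin (n i : ℤ) : M.πFil n i →ₗ[R] M.πGr n i :=
  { M.grHom n i with map_smul' := LinearStructure.gr_smul n i }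

/-- The boundary map `π_i(gr^n M) → π_{i-1}(fil^{n+1} M)` as an `R`-linear map. -/
def bdLin (n i : ℤ) : M.πGr n i →ₗ[R] M.πFil (n + 1) (i - 1) :=
  { M.bdHom n i with map_smul' := LinearStructure.bd_smul n i }

theorem bdLin_grLin (n i : ℤ) (y : M.πFil n i) : M.bdLin R n i (M.grLin R n i y) = 0 :=
  πBoundary_πToCofib _ i y

theorem trLin_trLin {a b c : ℤ} (h : a ≤ b) (h' : b ≤ c) (i : ℤ) (x : M.πFil c i) :
    M.trLin R h i (M.trLin R h' i x) = M.trLin R (h.trans h') i x := by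
  change πMap (M.tr h) i (πMap (M.tr h') i x) = πMap (M.tr (h.trans h')) i x
  refine (πMap_comp _ _ i x).symm.trans ?_
  have : M.tr h' ≫ M.tr h = M.tr (h.trans h') := (M.fil.map_comp _ _).symm
  rw [this]

/-! ### The spectral sequence

The pages are numbered so that `r : ℕ` stands for the page `E_{r+1}`; the first page is
`E_1^{n,i} = π_i(gr^n M)`, and the differential of the page `E_{r+1}` goes from the spot `(n, i)`
to the spot `(n + 1 + r, i - 1)`. -/

/-- The cycles `Z_{r+1}^{n,i} ⊆ π_i(gr^n M)`: the elements whose boundary in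
`π_{i-1}(fil^{n+1} M)` comes from `π_{i-1}(fil^{n+1+r} M)`. -/
def cycles (r : ℕ) (n i : ℤ) : Submodule R (M.πGr n i) :=
  (LinearMap.range (M.trLin R (by lia : n + 1 ≤ n + 1 + r) (i - 1))).comap (M.bdLin R n i)

/-- The boundaries `B_{r+1}^{n,i} ⊆ π_i(gr^n M)`: the image of the kernel of
`π_i(fil^n M) → π_i(fil^{n-r} M)`. -/
def boundaries (r : ℕ) (n i : ℤ) : Submodule R (M.πGr n i) :=
  (LinearMap.ker (M.trLin R (by lia : n - r ≤ n) i)).map (M.grLin R n i)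

/-- The page `E_{r+1}^{n,i} = Z_{r+1}^{n,i} / B_{r+1}^{n,i}`. -/
abbrev Page (r : ℕ) (n i : ℤ) : Type u :=
  M.cycles R r n i ⧸ (M.boundaries R r n i).comap (M.cycles R r n i).subtype

theorem grLin_mem_cycles (r : ℕ) (n i : ℤ) (y : M.πFil n i) :
    M.grLin R n i y ∈ M.cycles R r n i :=
  ⟨0, by rw [map_zero, bdLin_grLin]⟩

/-- The map `π_i(fil^n M) → E_{r+1}^{n,i}`. -/
def filToPage (r : ℕ) (n i : ℤ) : M.πFil n i →ₗ[R] M.Page R r n i :=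
  (Submodule.mkQ _).comp
    ((M.grLin R n i).codRestrict (M.cycles R r n i) (M.grLin_mem_cycles R r n i))

theorem filToPage_eq_zero {r : ℕ} {n i : ℤ} {y : M.πFil (n + 1 + r) i}
    (hy : M.trLin R (by lia : n + 1 ≤ n + 1 + r) i y = 0) :
    M.filToPage R r (n + 1 + r) i y = 0 := by
  refine (Submodule.Quotient.mk_eq_zero _).2 ⟨y, ?_, rfl⟩
  rw [SetLike.mem_coe, LinearMap.mem_ker,
    ← M.trLin_trLin R (by lia : n + 1 + r - r ≤ n + 1) (by lia : n + 1 ≤ n + 1 + r), hy, map_zero]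

/-- The differential on cycles: if the boundary of `x` is the image of `y`, then `x` is sent to
the class of the image of `y` in `π_{i-1}(gr^{n+1+r} M)`. -/
def preDifferential (r : ℕ) (n i : ℤ) :
    M.cycles R r n i →ₗ[R] M.Page R r (n + 1 + r) (i - 1) where
  toFun x := M.filToPage R r (n + 1 + r) (i - 1) x.2.choose
  map_add' x x' := by
    rw [← map_add, ← sub_eq_zero, ← map_sub]
    refine M.filToPage_eq_zero R ?_
    rw [map_sub, map_add, x.2.choose_spec, x'.2.choose_spec, (x + x').2.choose_spec]
    simp
  map_smul' c x := by
    rw [RingHom.id_apply, ← map_smul, ← sub_eq_zero, ← map_sub]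
    refine M.filToPage_eq_zero R ?_
    rw [map_sub, map_smul, x.2.choose_spec, (c • x).2.choose_spec]
    simp

theorem preDifferential_apply (r : ℕ) (n i : ℤ) (x : M.cycles R r n i)
    (y : M.πFil (n + 1 + r) (i - 1))
    (h : M.trLin R (by lia : n + 1 ≤ n + 1 + r) (i - 1) y = M.bdLin R n i x) :
    M.preDifferential R r n i x = M.filToPage R r (n + 1 + r) (i - 1) y := by
  change M.filToPage R r (n + 1 + r) (i - 1) x.2.choose = _
  rw [← sub_eq_zero, ← map_sub]
  refine M.filToPage_eq_zero R ?_
  rw [map_sub, x.2.choose_spec, h, sub_self]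

/-- The differential `d_{r+1} : E_{r+1}^{n,i} → E_{r+1}^{n+1+r,i-1}`. -/
def differential (r : ℕ) (n i : ℤ) :
    M.Page R r n i →ₗ[R] M.Page R r (n + 1 + r) (i - 1) :=
  Submodule.liftQ _ (M.preDifferential R r n i) <| by
    rintro x ⟨y, -, hy⟩
    rw [LinearMap.mem_ker, M.preDifferential_apply R r n i x 0, map_zero]
    rw [map_zero, ← Submodule.subtype_apply, ← hy, bdLin_grLin]

/-- The spectral sequence degenerates after tensoring with the fraction field: every
differential `d_r`, `r ≥ 1`, becomes zero. -/
def DegeneratesRationally : Prop :=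
  ∀ (r : ℕ) (n i : ℤ), (M.differential R r n i).baseChange (FractionRing R) = 0

/-! ### Convergence -/

/-- The filtration `F^n π_i(M) = im(π_i(fil^n M) → π_i(M))`. -/
def F (n i : ℤ) : Submodule R (M.πTot i) := LinearMap.range (M.totLin R n i)

/-- The infinite cycles `Z_∞ = ⋂_r Z_r`. -/
def cyclesInf (n i : ℤ) : Submodule R (M.πGr n i) := ⨅ r, M.cycles R r n i

/-- The infinite boundaries `B_∞ = ⋃_r B_r`. -/
def boundariesInf (n i : ℤ) : Submodule R (M.πGr n i) := ⨆ r, M.boundaries R r n i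

/-- The limit page `E_∞^{n,i} = Z_∞^{n,i} / B_∞^{n,i}`. -/
abbrev PageInf (n i : ℤ) : Type u :=
  M.cyclesInf R n i ⧸ (M.boundariesInf R n i).comap (M.cyclesInf R n i).subtype

/-- The graded piece `gr_F^n π_i(M) = F^n π_i(M) / F^{n+1} π_i(M)`. -/
abbrev GrF (n i : ℤ) : Type u :=
  M.F R n i ⧸ (M.F R (n + 1) i).comap (M.F R n i).subtype

/-- The map `π_i(fil^n M) → E_∞^{n,i}`. -/
def filToPageInf (n i : ℤ) : M.πFil n i →ₗ[R] M.PageInf R n i :=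
  (Submodule.mkQ _).comp ((M.grLin R n i).codRestrict (M.cyclesInf R n i) fun y =>
    (Submodule.mem_iInf _).2 fun r => M.grLin_mem_cycles R r n i y)

/-- The map `π_i(fil^n M) → gr_F^n π_i(M)`. -/
def filToGrF (n i : ℤ) : M.πFil n i →ₗ[R] M.GrF R n i :=
  (Submodule.mkQ _).comp (M.totLin R n i).rangeRestrict

/-- The spectral sequence converges strongly to `π_*(M)`: the filtration `F` of each `π_i(M)` is
exhaustive, Hausdorff and complete, and `gr_F^n π_i(M) ≅ E_∞^{n,i}` by the canonical
correspondence (the two classes of an element of `π_i(fil^n M)` are identified). -/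
structure ConvergesStrongly : Prop where
  exhaustive : ∀ i, ⨆ n, M.F R n i = ⊤
  hausdorff : ∀ i, ⨅ n, M.F R n i = ⊥
  complete : ∀ (i : ℤ) (x : ℤ → M.πTot i), (∀ n, x (n + 1) - x n ∈ M.F R n i) →
    ∃ y, ∀ n, y - x n ∈ M.F R n i
  grIso : ∀ n i, ∃ e : M.GrF R n i ≃ₗ[R] M.PageInf R n i,
    ∀ y, e (M.filToGrF R n i y) = M.filToPageInf R n i y

/-- Local finiteness: for every `i`, only finitely many `n` contribute to the filtration
of `π_i(M)`. -/
def IsLocallyFinite : Prop := ∀ i, {n : ℤ | M.F R n i ≠ M.F R (n + 1) i}.Finite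

/-! ### Degeneration -/

/-- `M` is degenerate: all maps `π_i(fil^n M) → π_i(M)` are injective. -/
def IsDegenerate : Prop := ∀ n i, Function.Injective (M.totHom n i)

/-- The map `π_i(fil^n M)_tf → π_i(M)_tf` on torsion-free quotients. -/
def totTf (n i : ℤ) :
    (M.πFil n i ⧸ Submodule.torsion R (M.πFil n i)) →ₗ[R]
      (M.πTot i ⧸ Submodule.torsion R (M.πTot i)) :=
  Submodule.mapQ _ _ (M.totLin R n i) <| by
    rintro x ⟨a, ha⟩
    refine ⟨a, ?_⟩
    rw [Submonoid.smul_def] at ha ⊢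
    rw [← map_smul, ha, map_zero]

end Linear

end FilteredSpectrum

/-- For a uniformizer `ϖ`, a submodule `A ⊆ B` is saturated if `ϖ A = A ∩ ϖ B`. -/
def IsSaturated {R : Type*} [CommRing R] (ϖ : R) {B : Type*} [AddCommGroup B] [Module R B]
    (A : Submodule R B) : Prop :=
  A.map (LinearMap.lsmul R B ϖ) = A ⊓ (⊤ : Submodule R B).map (LinearMap.lsmul R B ϖ)

namespace FilteredSpectrum

variable (M : FilteredSpectrum.{u}) (R : Type v) [CommRing R] [M.LinearStructure R]

/-- `M` is saturated degenerate: it is degenerate and each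
`π_i(fil^n M)_tf → π_i(M)_tf` is (injective with) saturated (image). -/
def IsSaturatedDegenerate (ϖ : R) : Prop :=
  M.IsDegenerate ∧ ∀ n i, Function.Injective (M.totTf R n i) ∧
    IsSaturated ϖ (LinearMap.range (M.totTf R n i))

/-- `M` is split degenerate: it is degenerate and each `π_i(fil^n M) → π_i(M)` has an
`R`-linear retraction. -/
def IsSplitDegenerate : Prop :=
  M.IsDegenerate ∧ ∀ n i, ∃ s : M.πTot i →ₗ[R] M.πFil n i,
    s.comp (M.totLin R n i) = LinearMap.id

end FilteredSpectrum

end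

/-! The argument counts lengths. Torsion is left exact, so along the filtration `F` the torsion of
`π_i(M)` has length at most the sum of the lengths of the torsion of `F^n/F^{n+1} ≅ E_∞^n =
Z_∞^n/B_∞^n`. Rational degeneration makes every boundary in `π_i(gr^n M)` torsion
(`boundaries_le_torsion`), so the torsion of `E_∞^n` is shorter than that of `π_i(gr^n M)` by at
least the length of `B_∞^n` (`length_comap_boundariesInf_add`).

If the lengths of the torsion of the `π_i(gr^n M)` add up to that of `π_i(M)`, all these
inequalities are equalities (`add_le_and_le_of_sum_le`). Hence `B_∞ = 0`, and torsion classes of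
`F^n/F^{n+1}` lift to torsion of `F^n`, which is saturation. Moreover `B_∞ = 0` forces degeneration:
a class dying in `π_i(M)` already dies at some finite stage by exhaustiveness, so its image in
`gr^n` is a boundary, hence zero, and it lifts one step up. Iterating gives a compatible family,
hence a class in `π_i(lim fil^n M) = 0`. Conversely, saturation lifts torsion through each step, and
the lengths telescope.

For the split criterion the same count is applied to `Hom(X, -)` of the torsion modules, with `X`
the torsion of `π_i(gr^n M)`. Equality then lifts the identity of `X`; the torsion-free quotient is
free and lifts anyway, so each `F^n → π_i(gr^n M)` has a section. -/

namespace GenLoop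

variable {N X : Type*} [TopologicalSpace X] {x : X}

theorem homotopic_of_continuousMap {p q : Ω^ N X x} (H : C(I × (N → I), X))
    (h0 : ∀ y, H (0, y) = p y) (h1 : ∀ y, H (1, y) = q y)
    (hb : ∀ t, ∀ y ∈ Cube.boundary N, H (t, y) = x) : GenLoop.Homotopic p q :=
  ⟨{ toContinuousMap := H
     map_zero_left := h0
     map_one_left := h1
     prop' := fun t y hy => (hb t y hy).trans (p.2 y hy).symm }⟩

theorem Homotopic.exists_continuousMap {p q : Ω^ N X x} (h : GenLoop.Homotopic p q) :
    ∃ H : C(I × (N → I), X), (∀ y, H (0, y) = p y) ∧ (∀ y, H (1, y) = q y) ∧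
      ∀ t, ∀ y ∈ Cube.boundary N, H (t, y) = x := by
  obtain ⟨H⟩ := h
  exact ⟨H.toContinuousMap, H.map_zero_left, H.map_one_left,
    fun t y hy => (H.eq_fst t hy).trans (p.2 y hy)⟩

end GenLoop

/-! ### Exactness for cofibres, and lifting to homotopy limits -/

namespace Prespectrum

/-- The projection of the homotopy fibre to the source. -/
def HoFib.fst {X Y : Prespectrum.{u}} (f : X ⟶ Y) (k : ℤ) : C(HoFib f k, X.space k) :=
  ⟨fun p => p.1.1, continuous_fst.comp continuous_subtype_val⟩

/-- A null-homotopy of `f ∘ p`, run from the constant loop, is exactly the path coordinate of a lift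
of `p` to the homotopy fibre. Two indices are kept because the levels `2 - i + 1` and `2 - (i - 1)`
agree only propositionally. -/
theorem exists_of_map_eq_one {X Y : Prespectrum.{u}} (f : X ⟶ Y) {a b : ℤ} (h : a = b)
    (x : HomotopyGroup (Fin 2) (X.space b) (X.pt b))
    (hx : HomotopyGroup.map (Hom.app f b) (Hom.app_pt f b) x = 1) :
    ∃ z : HomotopyGroup (Fin 2) (HoFib f a) (HoFib.pt f a),
      HomotopyGroup.map ((X.levelCast h).comp (HoFib.fst f a)) (X.levelCast_pt h) z = x := by
  subst h
  induction x using Quotient.inductionOn with | _ p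
  rw [HomotopyGroup.one_def] at hx
  obtain ⟨H, h0, h1, hb⟩ := (Quotient.exact hx.symm : GenLoop.Homotopic _ _).exists_continuousMap
  refine ⟨⟦⟨⟨fun y => ⟨(p y, ⟨fun s => H (s, y), by fun_prop⟩), h0 y, h1 y⟩, ?_⟩, ?_⟩⟧, ?_⟩
  · refine Continuous.subtype_mk (Continuous.prodMk p.1.continuous ?_) _
    refine ContinuousMap.continuous_of_continuous_uncurry _ ?_
    change Continuous fun q : (Fin 2 → I) × I => H (q.2, q.1)
    fun_prop
  · intro y hy
    refine Subtype.ext (Prod.ext (p.2 y hy) ?_)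
    ext s
    exact hb s y hy
  · refine congrArg (Quotient.mk _) ?_
    ext y
    rfl

/-- The path coordinate of a point of the homotopy fibre is itself the null-homotopy. -/
theorem map_fst_eq_one {X Y : Prespectrum.{u}} (f : X ⟶ Y) {a b : ℤ} (h : a = b)
    (z : HomotopyGroup (Fin 2) (HoFib f a) (HoFib.pt f a)) :
    HomotopyGroup.map (Hom.app f b) (Hom.app_pt f b)
      (HomotopyGroup.map ((X.levelCast h).comp (HoFib.fst f a)) (X.levelCast_pt h) z) = 1 := by
  subst h
  induction z using Quotient.inductionOn with | _ q
  rw [HomotopyGroup.one_def]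
  refine (Quotient.sound (GenLoop.homotopic_of_continuousMap
    ⟨fun t => (q t.2).1.2 t.1, ?_⟩ ?_ ?_ ?_)).symm
  · have : Continuous fun t : I × (Fin 2 → I) => (q t.2).1.2 :=
      continuous_snd.comp (continuous_subtype_val.comp (q.1.continuous.comp continuous_snd))
    fun_prop
  · intro y
    exact (q y).2.1
  · intro y
    exact (q y).2.2
  · intro t y hy
    exact congrArg (fun z : HoFib f a => z.1.2 t) (q.2 y hy)

/-- Exactness of `π_i(cofib f) → π_{i-1}(X) → π_{i-1}(Y)`. -/
theorem exact_πBoundary_πMap {X Y : Prespectrum.{u}} (f : X ⟶ Y) (i : ℤ) :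
    Function.Exact (πBoundary f i) (πMap f (i - 1)) := by
  intro x
  constructor
  · intro hx
    exact exists_of_map_eq_one f (by ring : (2 - i) + 1 = 2 - (i - 1)) x hx
  · rintro ⟨z, rfl⟩
    exact map_fst_eq_one f (by ring : (2 - i) + 1 = 2 - (i - 1)) z

/-- The reparametrization `(t, v) ↦ min (1, 2t) (1 - v)` of the unit square. -/
def cornerFst (τ v : I) : I :=
  ⟨min 1 (2 * (τ : ℝ)) * (1 - v), by
    have := τ.2.1; have := τ.2.2; have := v.2.1; have := v.2.2
    exact ⟨mul_nonneg (le_min (by linarith) (by linarith)) (by linarith),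
      mul_le_one₀ (min_le_left _ _) (by linarith) (by linarith)⟩⟩

/-- The reparametrization `(t, v) ↦ max (0, 2t - 1) (1 - v) + v` of the unit square. -/
def cornerSnd (τ v : I) : I :=
  ⟨max 0 (2 * (τ : ℝ) - 1) * (1 - v) + v, by
    have := τ.2.1; have := τ.2.2; have := v.2.1; have := v.2.2
    have h0 : (0 : ℝ) ≤ max 0 (2 * (τ : ℝ) - 1) := le_max_left _ _
    have h1 : max 0 (2 * (τ : ℝ) - 1) ≤ 1 := max_le (by linarith) (by linarith)
    constructor
    · nlinarith
    · nlinarith⟩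

theorem continuous_cornerFst : Continuous fun q : I × I => cornerFst q.1 q.2 :=
  Continuous.subtype_mk (by fun_prop) _

theorem continuous_cornerSnd : Continuous fun q : I × I => cornerSnd q.1 q.2 :=
  Continuous.subtype_mk (by fun_prop) _

/-- For fixed `τ`, the corner maps trace in `v` the segment ending at `(0, 1)` whose starting point
moves with `τ` from `(0, 0)` through `(1, 0)` to `(1, 1)`. So they deform the edge `{0} × I` into
the edge `I × {1}` run backwards. -/
theorem corner_zero (v : I) : cornerFst 0 v = 0 ∧ cornerSnd 0 v = v := by
  constructor <;> ext <;> simp [cornerFst, cornerSnd]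

theorem corner_one (v : I) : cornerFst 1 v = σ v ∧ cornerSnd 1 v = 1 := by
  constructor <;> ext <;> norm_num [cornerFst, cornerSnd]

theorem corner_left (τ : I) : cornerSnd τ 0 = 0 ∨ cornerFst τ 0 = 1 := by
  rcases le_total (2 * τ : ℝ) 1 with h | h
  · left; ext; simp [cornerSnd, h]
  · right; ext; simp [cornerFst, h]

theorem corner_right (τ : I) : cornerFst τ 1 = 0 ∧ cornerSnd τ 1 = 1 := by
  constructor <;> ext <;> simp [cornerFst, cornerSnd]

theorem _root_.IsWeakHomotopyEquiv.map_bijective {X Y : Type*} [TopologicalSpace X]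
    [TopologicalSpace Y] {f : C(X, Y)} (hf : IsWeakHomotopyEquiv f) (n : ℕ) {x : X} {y : Y}
    (h : f x = y) : Function.Bijective (HomotopyGroup.map (N := Fin n) f h) := by
  subst h
  exact hf.2 n x

/-- The map of loop spaces induced by a pointed map. -/
def loopMap {X Y : Type*} [TopologicalSpace X] [TopologicalSpace Y] (f : C(X, Y)) {x : X} {y : Y}
    (h : f x = y) : C(Ω X x, Ω Y y) where
  toFun p := (p.map f.continuous).cast h.symm h.symm
  continuous_toFun := by
    refine Path.continuous_uncurry_iff.1 ?_
    change Continuous fun q : Ω X x × I => f (q.1 q.2)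
    fun_prop

/-- For fixed `s`, a null-homotopy in the cofibre gives a square in `Y_{k+1}`: one edge is the loop
of `p s`, the opposite edge and the bottom are constant, and the top is the image under `f` of a
loop in `X_{k+1}`. Sweeping across the square deforms the first edge into the top; delooping in `X`
and `Y` then gives the preimage. -/
theorem exists_map_eq {X Y : Prespectrum.{u}} (f : X ⟶ Y) {k : ℤ}
    (hX : IsWeakHomotopyEquiv (X.str k)) (hY : IsWeakHomotopyEquiv (Y.str k))
    (h : toCofibLevel f k (Y.pt k) = (cofib f).pt k)
    (y : HomotopyGroup (Fin 2) (Y.space k) (Y.pt k))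
    (hy : HomotopyGroup.map (toCofibLevel f k) h y = ⟦GenLoop.const⟧) :
    ∃ x, HomotopyGroup.map (Hom.app f k) (Hom.app_pt f k) x = y := by
  induction y using Quotient.inductionOn with | _ p
  obtain ⟨H, h0, h1, hb⟩ := (Quotient.exact hy : GenLoop.Homotopic _ _).exists_continuousMap
  have hH1 : Continuous fun q => (H q).1.1 :=
    continuous_fst.comp (continuous_subtype_val.comp H.continuous)
  have hH2 : Continuous fun q : (I × (Fin 2 → I)) × I => (H q.1).1.2 q.2 := by
    have : Continuous fun q => (H q).1.2 :=
      continuous_snd.comp (continuous_subtype_val.comp H.continuous)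
    fun_prop
  have e0 (s) : (H (0, s)).1.1 = X.pt (k + 1) := congrArg (fun z => z.1.1) (h0 s)
  have e1 (s) : (H (1, s)).1.1 = X.pt (k + 1) := congrArg (fun z => z.1.1) (h1 s)
  have eb (t s) (hs : s ∈ Cube.boundary (Fin 2)) : (H (t, s)).1.1 = X.pt (k + 1) :=
    congrArg (fun z => z.1.1) (hb t s hs)
  have d0 (s v) : (H (0, s)).1.2 v = Y.str k (p s) v := congrArg (fun z => z.1.2 v) (h0 s)
  have d1 (s v) : (H (1, s)).1.2 v = Y.pt (k + 1) := congrArg (fun z => z.1.2 v) (h1 s)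
  have db (t s v) (hs : s ∈ Cube.boundary (Fin 2)) : (H (t, s)).1.2 v = Y.pt (k + 1) :=
    congrArg (fun z => z.1.2 v) (hb t s hs)
  have b0 (q) : (H q).1.2 0 = Y.pt (k + 1) := (H q).2.1
  have b1 (q) : (H q).1.2 1 = Hom.app f (k + 1) (H q).1.1 := (H q).2.2
  -- The loop is reversed by `σ` to match the direction in which the sweep reaches the top edge.
  let w : Ω^ (Fin 2) (Ω (X.space (k + 1)) (X.pt (k + 1))) (Path.refl _) :=
    ⟨⟨fun s => ⟨⟨fun v => (H (σ v, s)).1.1, by fun_prop⟩, by simp [e1], by simp [e0]⟩,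
      Path.continuous_uncurry_iff.1 (by
        change Continuous fun q : (Fin 2 → I) × I => (H (σ q.2, q.1)).1.1
        fun_prop)⟩, fun s hs => by ext v; exact eb _ s hs⟩
  obtain ⟨x, hx⟩ := (hX.map_bijective 2 (X.str_pt k)).2 ⟦w⟧
  refine ⟨x, (hY.map_bijective 2 (Y.str_pt k)).1 ?_⟩
  have hL : loopMap (Hom.app f (k + 1)) (Hom.app_pt f (k + 1)) (Path.refl _) = Path.refl _ := by
    ext v
    exact Hom.app_pt f (k + 1)
  have key : HomotopyGroup.map (Y.str k) (Y.str_pt k)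
      (HomotopyGroup.map (Hom.app f k) (Hom.app_pt f k) x) =
      HomotopyGroup.map (loopMap (Hom.app f (k + 1)) (Hom.app_pt f (k + 1))) hL
        (HomotopyGroup.map (X.str k) (X.str_pt k) x) := by
    induction x using Quotient.inductionOn with | _ q
    refine congrArg (Quotient.mk _) ?_
    ext s v
    exact Hom.app_str f k (q s) v
  rw [key, hx]
  have hK : Continuous fun q : (I × (Fin 2 → I)) × I =>
      (H (cornerFst q.1.1 q.2, q.1.2)).1.2 (cornerSnd q.1.1 q.2) := by
    have h1 : Continuous fun q : (I × (Fin 2 → I)) × I => cornerFst q.1.1 q.2 :=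
      continuous_cornerFst.comp
        (by fun_prop : Continuous fun q : (I × (Fin 2 → I)) × I => (q.1.1, q.2))
    have h2 : Continuous fun q : (I × (Fin 2 → I)) × I => cornerSnd q.1.1 q.2 :=
      continuous_cornerSnd.comp
        (by fun_prop : Continuous fun q : (I × (Fin 2 → I)) × I => (q.1.1, q.2))
    exact hH2.comp (by fun_prop : Continuous fun q : (I × (Fin 2 → I)) × I =>
      ((cornerFst q.1.1 q.2, q.1.2), cornerSnd q.1.1 q.2))
  let K (q : I × (Fin 2 → I)) : Ω (Y.space (k + 1)) (Y.pt (k + 1)) :=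
    { toFun := fun v => (H (cornerFst q.1 v, q.2)).1.2 (cornerSnd q.1 v)
      continuous_toFun := hK.comp (by fun_prop : Continuous fun v : I => (q, v))
      source' := by
        rcases corner_left q.1 with h | h <;> rw [h]
        · exact b0 _
        · exact d1 _ _
      target' := by rw [(corner_right q.1).1, (corner_right q.1).2, b1, e0, Hom.app_pt] }
  refine (Quotient.sound (GenLoop.homotopic_of_continuousMap
    ⟨K, Path.continuous_uncurry_iff.1 hK⟩ ?_ ?_ ?_)).symm
  · intro s
    ext v
    change (H (cornerFst 0 v, s)).1.2 (cornerSnd 0 v) = _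
    rw [(corner_zero v).1, (corner_zero v).2, d0]
    rfl
  · intro s
    ext v
    change (H (cornerFst 1 v, s)).1.2 (cornerSnd 1 v) = _
    rw [(corner_one v).1, (corner_one v).2, b1]
    rfl
  · intro t s hs
    ext v
    exact db _ s _ hs

/-- For `Ω`-spectra, the kernel of `π_i(Y) → π_i(cofib f)` lies in the image of `π_i(X)`. -/
theorem exists_πMap_eq {X Y : Prespectrum.{u}} (hX : X.IsOmega) (hY : Y.IsOmega) (f : X ⟶ Y)
    (i : ℤ) (y : Y.π i) (hy : πToCofib f i y = 0) : ∃ x, πMap f i x = y :=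
  exists_map_eq f (hX _) (hY _) (by
    refine Subtype.ext (Prod.ext rfl ?_)
    ext s
    change Y.str (2 - i) (Y.pt (2 - i)) s = Y.pt (2 - i + 1)
    rw [Y.str_pt, Path.refl_apply]) y hy

/-- Every compatible family of classes in a tower lifts to the homotopy limit. -/
theorem exists_πHoLim_lift (F : ℤᵒᵖ ⥤ Prespectrum.{u}) (i : ℤ)
    (x : ∀ n : ℤ, (F.obj (.op n)).π i)
    (hx : ∀ n : ℤ, πMap (F.map (homOfLE (by lia : n ≤ n + 1)).op) i (x (n + 1)) = x n) :
    ∃ z : (holim F).π i, ∀ n, πLevelMap (X := holim F) (Y := F.obj (.op n)) (i := i) (j := i)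
      ⟨fun p : HoLim F (2 - i) => p.1.1 n,
        (continuous_apply n).comp (continuous_fst.comp continuous_subtype_val)⟩ rfl z = x n := by
  -- A point of the homotopy limit asks only for paths between consecutive terms, so arbitrarily
  -- chosen representatives and homotopies assemble without further coherence.
  choose p hp using fun n => Quotient.exists_rep
    (s := GenLoop.Homotopic.setoid (Fin 2) ((F.obj (.op n)).pt (2 - i))) (x n)
  have hH (n : ℤ) := by
    have := hx n
    rw [← hp, ← hp] at this
    exact (Quotient.exact this.symm : GenLoop.Homotopic _ _).exists_continuousMap
  choose H h0 h1 hb using hH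
  refine ⟨(⟦⟨⟨fun s => ⟨(fun n => p n s, fun n => ⟨fun t => H n (t, s), by fun_prop⟩),
    fun n => ⟨h0 n s, h1 n s⟩⟩, ?_⟩, ?_⟩⟧ :
      HomotopyGroup (Fin 2) (HoLim F (2 - i)) (HoLim.pt F (2 - i))), ?_⟩
  · refine Continuous.subtype_mk (Continuous.prodMk (continuous_pi fun n => (p n).1.continuous)
      (continuous_pi fun n => ContinuousMap.continuous_of_continuous_uncurry _ ?_)) _
    change Continuous fun q : (Fin 2 → I) × I => H n (q.2, q.1)
    fun_prop
  · intro s hs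
    refine Subtype.ext (Prod.ext ?_ ?_)
    · ext n
      exact (p n).2 s hs
    · ext n t
      exact hb n t s hs
  · intro n
    rw [← hp]
    rfl

end Prespectrum

/-! ### Lengths -/

section Length

variable {R : Type*} [CommRing R] {M N P : Type*} [AddCommGroup M] [AddCommGroup N]
  [AddCommGroup P] [Module R M] [Module R N] [Module R P]

theorem Module.length_le_add_of_exact {f : M →ₗ[R] N} {g : N →ₗ[R] P}
    (hf : Function.Injective f) (h : Function.Exact f g) :
    Module.length R N ≤ Module.length R M + Module.length R P := by
  have h' : Function.Exact f g.rangeRestrict := fun y => by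
    rw [← h y, ← Subtype.coe_inj]; rfl
  rw [Module.length_eq_add_of_exact f g.rangeRestrict hf g.surjective_rangeRestrict h']
  gcongr
  exact Module.length_le_of_injective (LinearMap.range g).subtype Subtype.val_injective

/-- The range of `g` has at least the length of `P`, and in finite length a proper submodule is
strictly shorter. -/
theorem LinearMap.surjective_of_exact_of_add_length_le {f : M →ₗ[R] N} {g : N →ₗ[R] P}
    (hf : Function.Injective f) (h : Function.Exact f g) (hN : Module.length R N ≠ ⊤)
    (hle : Module.length R M + Module.length R P ≤ Module.length R N) :
    Function.Surjective g := by
  have h' : Function.Exact f g.rangeRestrict := fun y => by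
    rw [← h y, ← Subtype.coe_inj]; rfl
  have hM : Module.length R M ≠ ⊤ := ne_top_of_le_ne_top hN (le_self_add.trans hle)
  have hP : Module.length R P ≠ ⊤ := ne_top_of_le_ne_top hN (le_add_self.trans hle)
  rw [Module.length_eq_add_of_exact f g.rangeRestrict hf g.surjective_rangeRestrict h',
    ENat.add_le_add_iff_left hM] at hle
  obtain ⟨_, _⟩ := isFiniteLength_iff_isNoetherian_isArtinian.1 (Module.length_ne_top_iff.1 hP)
  rw [← LinearMap.range_eq_top]
  by_contra hne
  exact absurd hle (not_le.2 (Submodule.length_lt hne))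

/-- The module is a quotient of a finite power of `R ⧸ (c)`, which has finite length. -/
theorem Module.length_ne_top_of_smul_eq_zero [IsDomain R] [IsPrincipalIdealRing R]
    [Module.Finite R M] {c : R} (hc : c ≠ 0) (h : ∀ x : M, c • x = 0) :
    Module.length R M ≠ ⊤ := by
  obtain ⟨n, s, hs⟩ := Module.Finite.exists_fin (R := R) (M := M)
  have hfin : Module.length R (R ⧸ Ideal.span {c}) ≠ ⊤ :=
    Module.length_ne_top_iff.2
      (isFiniteLength_quotient_span_singleton R (mem_nonZeroDivisors_of_ne_zero hc))
  let e (j : Fin n) : (R ⧸ Ideal.span {c}) →ₗ[R] M :=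
    Submodule.liftQ _ (LinearMap.toSpanSingleton R M (s j)) <| by
      rw [Ideal.span, Submodule.span_le, Set.singleton_subset_iff]
      exact h (s j)
  have hsurj : Function.Surjective
      (LinearMap.lsum R (fun _ : Fin n => R ⧸ Ideal.span {c}) R e) := by
    rw [← LinearMap.range_eq_top, ← top_le_iff, ← hs, Submodule.span_le]
    rintro _ ⟨j, rfl⟩
    refine ⟨Pi.single j (Submodule.Quotient.mk 1), ?_⟩
    rw [LinearMap.lsum_piSingle]
    exact one_smul R (s j)
  refine ne_top_of_le_ne_top ?_ (Module.length_le_of_surjective _ hsurj)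
  rw [Module.length_pi_of_fintype]
  exact WithTop.sum_ne_top.2 fun _ _ => hfin

theorem Module.length_torsion_ne_top [IsDomain R] [IsPrincipalIdealRing R] [Module.Finite R M] :
    Module.length R (Submodule.torsion R M) ≠ ⊤ := by
  obtain ⟨c, hc, hc0⟩ := Submodule.annihilator_top_inter_nonZeroDivisors
    (Submodule.torsion_isTorsion (R := R) (M := M))
  exact Module.length_ne_top_of_smul_eq_zero (nonZeroDivisors.ne_zero hc0)
    fun x => Submodule.mem_annihilator.1 hc x trivial

/-- Evaluation on finitely many generators of `N` embeds the Hom module in a finite power of `M`. -/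
theorem Module.length_linearMap_ne_top [Module.Finite R N] (hM : Module.length R M ≠ ⊤) :
    Module.length R (N →ₗ[R] M) ≠ ⊤ := by
  obtain ⟨n, s, hs⟩ := Module.Finite.exists_fin (R := R) (M := N)
  have hinj : Function.Injective
      (LinearMap.pi fun j : Fin n => LinearMap.applyₗ (R := R) (M₂ := M) (s j)) := by
    intro f g hfg
    refine LinearMap.ext_on_range hs fun j => congrFun hfg j
  refine ne_top_of_le_ne_top ?_ (Module.length_le_of_injective _ hinj)
  rw [Module.length_pi_of_fintype]
  exact WithTop.sum_ne_top.2 fun _ _ => hM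

end Length

/-! ### Torsion submodules -/

namespace Submodule

section Torsion

variable {R : Type*} [CommRing R] {M N P : Type*} [AddCommGroup M] [AddCommGroup N]
  [AddCommGroup P] [Module R M] [Module R N] [Module R P]

theorem map_mem_torsion (f : M →ₗ[R] N) {x : M} (hx : x ∈ torsion R M) : f x ∈ torsion R N := by
  obtain ⟨a, ha⟩ := hx
  refine ⟨a, ?_⟩
  rw [Submonoid.smul_def] at ha ⊢
  rw [← map_smul, ha, map_zero]

theorem mem_torsion_of_injective {f : M →ₗ[R] N} (hf : Function.Injective f) {x : M}
    (hx : f x ∈ torsion R N) : x ∈ torsion R M := by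
  obtain ⟨a, ha⟩ := hx
  refine ⟨a, hf ?_⟩
  rw [Submonoid.smul_def] at ha ⊢
  rw [map_smul, ha, map_zero]

theorem mem_torsion_of_smul_mem {x : M} {a : R} (ha : a ∈ nonZeroDivisors R)
    (hx : a • x ∈ torsion R M) : x ∈ torsion R M := by
  obtain ⟨b, hb⟩ := hx
  exact ⟨b * ⟨a, ha⟩, by rw [mul_smul]; exact hb⟩

/-- The map induced on torsion submodules. -/
def torsionMap (f : M →ₗ[R] N) : torsion R M →ₗ[R] torsion R N :=
  f.restrict fun _ hx => map_mem_torsion f hx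

@[simp]
theorem coe_torsionMap (f : M →ₗ[R] N) (x : torsion R M) : (torsionMap f x : N) = f x := rfl

theorem torsionMap_injective {f : M →ₗ[R] N} (hf : Function.Injective f) :
    Function.Injective (torsionMap f) := fun _ _ h =>
  Subtype.ext (hf (congrArg Subtype.val h))

theorem torsionMap_exact {f : M →ₗ[R] N} {g : N →ₗ[R] P} (hf : Function.Injective f)
    (h : Function.Exact f g) : Function.Exact (torsionMap f) (torsionMap g) := by
  intro y
  rw [← Subtype.coe_inj, coe_torsionMap, coe_zero, h]
  constructor
  · rintro ⟨x, hx⟩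
    exact ⟨⟨x, mem_torsion_of_injective hf (by rw [hx]; exact y.2)⟩, Subtype.ext hx⟩
  · rintro ⟨x, rfl⟩
    exact ⟨x, rfl⟩

/-- The equivalence induced on torsion submodules. -/
noncomputable def torsionEquiv (e : M ≃ₗ[R] N) : torsion R M ≃ₗ[R] torsion R N :=
  LinearEquiv.ofBijective (torsionMap e.toLinearMap) ⟨torsionMap_injective e.injective, fun y =>
    ⟨⟨e.symm y, map_mem_torsion e.symm.toLinearMap y.2⟩, Subtype.ext (e.apply_symm_apply _)⟩⟩

/-- Dividing out a torsion submodule lowers the length of the torsion by its length. -/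
theorem length_torsion_quotient {B : Submodule R M} (hB : B ≤ torsion R M) :
    Module.length R (torsion R M) =
      Module.length R B + Module.length R (torsion R (M ⧸ B)) := by
  refine Module.length_eq_add_of_exact (inclusion hB) (torsionMap B.mkQ) (inclusion_injective hB)
    ?_ ?_
  · rintro ⟨y, hy⟩
    obtain ⟨x, rfl⟩ := B.mkQ_surjective y
    refine ⟨⟨x, ?_⟩, rfl⟩
    obtain ⟨a, ha⟩ := hy
    rw [Submonoid.smul_def, ← map_smul, mkQ_apply, Quotient.mk_eq_zero] at ha
    exact mem_torsion_of_smul_mem a.2 (hB ha)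
  · intro x
    rw [← Subtype.coe_inj, coe_torsionMap, mkQ_apply, coe_zero, Quotient.mk_eq_zero]
    exact ⟨fun hx => ⟨⟨x, hx⟩, rfl⟩, by rintro ⟨y, rfl⟩; exact y.2⟩

end Torsion

end Submodule

/-- Left exactness of `Hom(X, -)`. -/
theorem LinearMap.exact_compRight {R : Type*} [CommRing R] {M N P X : Type*} [AddCommGroup M]
    [AddCommGroup N] [AddCommGroup P] [AddCommGroup X] [Module R M] [Module R N] [Module R P]
    [Module R X] {f : M →ₗ[R] N} {g : N →ₗ[R] P} (hf : Function.Injective f)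
    (h : Function.Exact f g) :
    Function.Injective (LinearMap.compRight (M := X) R f) ∧
      Function.Exact (LinearMap.compRight (M := X) R f) (LinearMap.compRight (M := X) R g) := by
  constructor
  · intro φ ψ H
    ext x
    exact hf (LinearMap.congr_fun H x)
  · intro φ
    constructor
    · intro H
      have hmem (x : X) : φ x ∈ LinearMap.range f := (h _).1 (LinearMap.congr_fun H x)
      refine ⟨(LinearEquiv.ofInjective f hf).symm.toLinearMap ∘ₗ φ.codRestrict _ hmem, ?_⟩
      ext x
      exact congrArg Subtype.val
        ((LinearEquiv.ofInjective f hf).apply_symm_apply (φ.codRestrict _ hmem x))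
    · rintro ⟨ψ, rfl⟩
      ext x
      exact h.apply_apply_eq_zero _

/-! ### Telescoping -/

section Telescope

variable {a c g : ℤ → ℕ∞}

theorem sum_Ico_int_add_one {M : Type*} [AddCommMonoid M] (f : ℤ → M) {m n : ℤ} (h : m ≤ n) :
    ∑ k ∈ Finset.Ico m (n + 1), f k = (∑ k ∈ Finset.Ico m n, f k) + f n := by
  rw [← Finset.insert_Ico_right_eq_Ico_add_one h, Finset.sum_insert Finset.right_notMem_Ico,
    add_comm]

theorem sum_Ico_int_consecutive {M : Type*} [AddCommMonoid M] (f : ℤ → M) {l m n : ℤ}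
    (h : l ≤ m) (h' : m ≤ n) :
    (∑ k ∈ Finset.Ico l m, f k) + ∑ k ∈ Finset.Ico m n, f k = ∑ k ∈ Finset.Ico l n, f k := by
  rw [← Finset.sum_union (Finset.Ico_disjoint_Ico_consecutive l m n),
    Finset.Ico_union_Ico_eq_Ico h h']

theorem le_add_sum_Ico_of_le_succ (h : ∀ n, a n ≤ a (n + 1) + c n) {m n : ℤ} (hmn : m ≤ n) :
    a m ≤ a n + ∑ k ∈ Finset.Ico m n, c k := by
  induction n, hmn using Int.leInduction with
  | base => simp
  | succ n hmn ih =>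
    rw [sum_Ico_int_add_one _ hmn, add_comm _ (c n), ← add_assoc]
    exact ih.trans (by gcongr; exact h n)

theorem eq_add_sum_Ico_of_eq_succ (h : ∀ n, a n = a (n + 1) + c n) {m n : ℤ} (hmn : m ≤ n) :
    a m = a n + ∑ k ∈ Finset.Ico m n, c k := by
  induction n, hmn using Int.leInduction with
  | base => simp
  | succ n hmn ih =>
    rw [sum_Ico_int_add_one _ hmn, add_comm _ (c n), ← add_assoc, ← h n, ih]

/-- If a bounded function on `ℤ` drops at each step by at most `c n ≤ g n`, and its total drop is
at least the sum of the `g n`, then all drops are exactly `g n = c n`. -/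
theorem add_le_and_le_of_sum_le {N₀ N₁ : ℤ} (hac : ∀ n, a n ≤ a (n + 1) + c n)
    (hcg : ∀ n, c n ≤ g n) (h₀ : ∀ n ≤ N₀, a n = a N₀) (h₁ : ∀ n, N₁ ≤ n → a n = 0)
    (hfin : a N₀ ≠ ⊤) (hsum : ∀ s : Finset ℤ, ∑ n ∈ s, g n ≤ a N₀) (n : ℤ) :
    a (n + 1) + g n ≤ a n ∧ g n ≤ c n := by
  have hg (s : Finset ℤ) : ∑ n ∈ s, g n ≠ ⊤ := ne_top_of_le_ne_top hfin (hsum s)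
  have upper (m : ℤ) : ∃ M, m ≤ M ∧ a m ≤ ∑ k ∈ Finset.Ico m M, g k := by
    refine ⟨max m N₁, le_max_left _ _, ?_⟩
    have := le_add_sum_Ico_of_le_succ hac (le_max_left m N₁)
    rw [h₁ _ (le_max_right _ _), zero_add] at this
    exact this.trans (Finset.sum_le_sum fun k _ => hcg k)
  obtain ⟨M, hM, haM⟩ := upper (n + 1)
  -- With `m` below both `n` and `N₀`, the sum of `g` over `[m, M)` is at most `a N₀ = a m`.
  -- Bounding the part from `n + 1` on below by `a (n + 1)`, and `a m` above by `a n` plus the part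
  -- before `n`, leaves the claim after cancelling that finite part.
  have key : a (n + 1) + g n ≤ a n := by
    set m := min n N₀
    have hmn : m ≤ n := min_le_left _ _
    have h1 : a N₀ ≤ a n + ∑ k ∈ Finset.Ico m n, g k := by
      rw [← h₀ m (min_le_right _ _)]
      exact (le_add_sum_Ico_of_le_succ hac hmn).trans
        (by gcongr with k; exact hcg k)
    refine (ENat.add_le_add_iff_right (hg (Finset.Ico m n))).1 (le_trans ?_ h1)
    refine le_trans ?_ (hsum (Finset.Ico m M))
    rw [← sum_Ico_int_consecutive g (by lia : m ≤ n + 1) hM, sum_Ico_int_add_one g hmn,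
      add_comm _ (∑ k ∈ Finset.Ico m n, g k), add_comm (a (n + 1)), ← add_assoc]
    gcongr
  refine ⟨key, (ENat.add_le_add_iff_left (ne_top_of_le_ne_top (hg _) haM)).1
    (key.trans (hac n))⟩

/-- Every interval reaching below `N₀` and beyond `N₁` has the same sum `a N₀`, and each finite set
of indices lies in such an interval. -/
theorem eq_iSup_sum_of_eq_succ {N₀ N₁ : ℤ} (h : ∀ n, a n = a (n + 1) + g n)
    (h₀ : ∀ n ≤ N₀, a n = a N₀) (h₁ : ∀ n, N₁ ≤ n → a n = 0) :
    a N₀ = ⨆ s : Finset ℤ, ∑ n ∈ s, g n := by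
  have hIco (m M : ℤ) (hm : m ≤ N₀) (hM : N₁ ≤ M) (hmM : m ≤ M) :
      a N₀ = ∑ k ∈ Finset.Ico m M, g k := by
    rw [← h₀ m hm, eq_add_sum_Ico_of_eq_succ h hmM, h₁ M hM, zero_add]
  refine le_antisymm ?_ (iSup_le fun s => ?_)
  · rw [hIco N₀ (max N₀ N₁) le_rfl (le_max_right _ _) (le_max_left _ _)]
    exact le_iSup (fun s : Finset ℤ => ∑ n ∈ s, g n) _
  · obtain ⟨l, hl⟩ := s.bddBelow
    obtain ⟨u, hu⟩ := s.bddAbove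
    rw [hIco (min l N₀) (max (max (u + 1) N₁) (min l N₀)) (min_le_right _ _)
      ((le_max_right _ _).trans (le_max_left _ _)) (le_max_right _ _)]
    refine Finset.sum_le_sum_of_subset fun k hk => Finset.mem_Ico.2 ⟨?_, ?_⟩
    · exact (min_le_left _ _).trans (hl hk)
    · exact (Int.lt_add_one_iff.2 (hu hk)).trans_le ((le_max_left _ _).trans (le_max_left _ _))

end Telescope

/-! ### Finite filtrations of a module over a principal ideal domain -/

section Filtration

open Submodule

variable {R : Type*} [CommRing R] {A : Type*} [AddCommGroup A] [Module R A] {F : ℤ → Submodule R A}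
  {G : ℤ → Type*} [∀ n, AddCommGroup (G n)] [∀ n, Module R (G n)]

theorem exact_inclusion_of_ker (hF : ∀ n, F (n + 1) ≤ F n) (q : ∀ n, F n →ₗ[R] G n)
    (hq : ∀ n (x : F n), q n x = 0 ↔ (x : A) ∈ F (n + 1)) (n : ℤ) :
    Function.Exact (inclusion (hF n)) (q n) := fun x => by
  rw [hq]
  exact ⟨fun hx => ⟨⟨x, hx⟩, rfl⟩, by rintro ⟨y, rfl⟩; exact y.2⟩

/-- If the lengths of `Hom(X, (F n / F (n + 1))_tors)` add up to at most the length of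
`Hom(X, A_tors)`, then maps from `X` to the torsion of `F n / F (n + 1)` lift to the torsion
of `F n`. -/
theorem exists_torsion_lift_of_sum_le [IsDomain R] [IsPrincipalIdealRing R] [Module.Finite R A]
    (hF : ∀ n, F (n + 1) ≤ F n) (q : ∀ n, F n →ₗ[R] G n)
    (hq : ∀ n (x : F n), q n x = 0 ↔ (x : A) ∈ F (n + 1))
    {N₀ N₁ : ℤ} (h₀ : ∀ n ≤ N₀, F n = ⊤) (h₁ : ∀ n, N₁ ≤ n → F n = ⊥)
    (X : Type*) [AddCommGroup X] [Module R X] [Module.Finite R X] (g : ℤ → ℕ∞)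
    (hg : ∀ n, Module.length R (X →ₗ[R] torsion R (G n)) ≤ g n)
    (hsum : ∀ s : Finset ℤ, ∑ n ∈ s, g n ≤ Module.length R (X →ₗ[R] torsion R A)) (n : ℤ) :
    g n ≤ Module.length R (X →ₗ[R] torsion R (G n)) ∧
      ∀ φ : X →ₗ[R] torsion R (G n), ∃ ψ : X →ₗ[R] torsion R (F n),
        torsionMap (q n) ∘ₗ ψ = φ := by
  let a (n : ℤ) : ℕ∞ := Module.length R (X →ₗ[R] torsion R (F n))
  have hinj (n) : Function.Injective (torsionMap (inclusion (hF n))) :=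
    torsionMap_injective (inclusion_injective (hF n))
  have hex (n) : Function.Exact (torsionMap (inclusion (hF n))) (torsionMap (q n)) :=
    torsionMap_exact (inclusion_injective (hF n)) (exact_inclusion_of_ker hF q hq n)
  -- Both torsion and `Hom(X, -)` are left exact, so the length drops at each step by at most that
  -- of `Hom(X, (G n)_tors)`.
  have hX (n) := LinearMap.exact_compRight (X := X) (hinj n) (hex n)
  have htop (n) (hn : n ≤ N₀) : a n = Module.length R (X →ₗ[R] torsion R A) := by
    refine LinearEquiv.length_eq (LinearEquiv.congrRight (torsionEquiv ?_))
    exact LinearEquiv.ofTop _ (h₀ n hn)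
  have hfin (n) : a n ≠ ⊤ := Module.length_linearMap_ne_top Module.length_torsion_ne_top
  have := add_le_and_le_of_sum_le (a := a) (g := g) (N₀ := N₀) (N₁ := N₁)
    (fun n => Module.length_le_add_of_exact (hX n).1 (hX n).2) hg
    (fun n hn => (htop n hn).trans (htop N₀ le_rfl).symm)
    (fun n hn => by
      have : Subsingleton (F n) := by rw [h₁ n hn]; infer_instance
      exact Module.length_eq_zero)
    (hfin _) (fun s => (hsum s).trans (htop N₀ le_rfl).ge) n
  have hsurj : Function.Surjective (LinearMap.compRight (M := X) R (torsionMap (q n))) :=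
    LinearMap.surjective_of_exact_of_add_length_le
      (f := LinearMap.compRight (M := X) R (torsionMap (inclusion (hF n)))) (hX n).1 (hX n).2
      (hfin n) (le_trans (by gcongr; exact hg n) this.1)
  exact ⟨this.2, hsurj⟩

/-- If torsion classes of `F n / F (n + 1)` lift to torsion elements of `F n`, then the lengths
of the torsion of these quotients add up to the length of the torsion of `A`. -/
theorem length_torsion_eq_iSup_sum (hF : ∀ n, F (n + 1) ≤ F n) (q : ∀ n, F n →ₗ[R] G n)
    (hq : ∀ n (x : F n), q n x = 0 ↔ (x : A) ∈ F (n + 1))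
    {N₀ N₁ : ℤ} (h₀ : ∀ n ≤ N₀, F n = ⊤) (h₁ : ∀ n, N₁ ≤ n → F n = ⊥)
    (hlift : ∀ n, Function.Surjective (torsionMap (q n))) :
    Module.length R (torsion R A) =
      ⨆ s : Finset ℤ, ∑ n ∈ s, Module.length R (torsion R (G n)) := by
  let a (n : ℤ) : ℕ∞ := Module.length R (torsion R (F n))
  have htop (n) (hn : n ≤ N₀) : a n = Module.length R (torsion R A) :=
    LinearEquiv.length_eq (torsionEquiv (LinearEquiv.ofTop _ (h₀ n hn)))
  rw [← htop N₀ le_rfl]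
  refine eq_iSup_sum_of_eq_succ (a := a) (N₁ := N₁) (fun n => ?_)
    (fun n hn => (htop n hn).trans (htop N₀ le_rfl).symm) (fun n hn => ?_)
  · exact Module.length_eq_add_of_exact (torsionMap (inclusion (hF n))) (torsionMap (q n))
      (torsionMap_injective (inclusion_injective (hF n))) (hlift n)
      (torsionMap_exact (inclusion_injective (hF n)) (exact_inclusion_of_ker hF q hq n))
  · have : Subsingleton (F n) := by rw [h₁ n hn]; infer_instance
    exact Module.length_eq_zero

/-- If torsion classes of `F n / F (n + 1)` lift to torsion elements of `F n`, then torsion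
classes of `A / F n` lift to torsion elements of `A`. -/
theorem exists_torsion_sub_mem (q : ∀ n, F n →ₗ[R] G n)
    (hq : ∀ n (x : F n), q n x = 0 ↔ (x : A) ∈ F (n + 1)) (hF : Antitone F)
    {N₀ : ℤ} (h₀ : ∀ n ≤ N₀, F n = ⊤)
    (hlift : ∀ n, Function.Surjective (torsionMap (q n))) (n : ℤ) (x : A) (c : R)
    (hc : c ∈ nonZeroDivisors R) (hx : c • x ∈ F n) :
    ∃ t ∈ torsion R A, x - t ∈ F n := by
  obtain hn | hn := le_total n N₀
  · exact ⟨0, zero_mem _, by rw [h₀ n hn]; trivial⟩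
  have key (m : ℤ) (hm : N₀ ≤ m) : m ≤ n → ∃ t ∈ torsion R A, x - t ∈ F m := by
    induction m, hm using Int.leInduction with
    | base => exact fun _ => ⟨0, zero_mem _, by rw [h₀ N₀ le_rfl]; trivial⟩
    | succ m hm ih =>
      intro hmn
      obtain ⟨t, ⟨b, hb⟩, hxt⟩ := ih (by lia)
      have hbt : (b : R) • t = 0 := hb
      -- Since `b` kills `t`, the product `b * c` moves `x - t` into `F n ≤ F (m + 1)`. The class of
      -- `x - t` in `G m` is thus torsion, and subtracting a torsion lift `u` improves `t` by one
      -- step.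
      have hmem : ((b : R) * c) • (x - t) ∈ F (m + 1) := by
        rw [smul_sub, mul_smul, mul_comm, mul_smul c, hbt, smul_zero, sub_zero]
        exact smul_mem _ _ (hF hmn hx)
      obtain ⟨u, hu⟩ := hlift m ⟨q m ⟨x - t, hxt⟩, ⟨b * ⟨c, hc⟩, by
        change ((b : R) * c) • q m _ = 0
        rw [← map_smul, hq]
        exact hmem⟩⟩
      refine ⟨t + u, add_mem ⟨b, hb⟩ (map_mem_torsion (F m).subtype u.2), ?_⟩
      have : q m (⟨x - t, hxt⟩ - u) = 0 := by
        rw [map_sub, sub_eq_zero]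
        exact (congrArg Subtype.val hu).symm
      rw [hq] at this
      rw [← sub_sub]
      exact this
  exact key n hn le_rfl

/-- A surjection from a module over a principal ideal domain onto a finitely generated module
splits if the torsion submodule of the target lifts. -/
theorem exists_section_of_torsion_section [IsDomain R] [IsPrincipalIdealRing R] {B C : Type*}
    [AddCommGroup B] [AddCommGroup C] [Module R B] [Module R C] [Module.Finite R C]
    (q : B →ₗ[R] C) (hq : Function.Surjective q) (t : torsion R C →ₗ[R] B)
    (ht : ∀ x, q (t x) = x) : ∃ s : C →ₗ[R] B, q ∘ₗ s = LinearMap.id := by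
  let π := (torsion R C).mkQ
  have : Module.Free R (C ⧸ torsion R C) := Module.free_of_finite_type_torsion_free'
  obtain ⟨τ, hτ⟩ := Module.projective_lifting_property π LinearMap.id (mkQ_surjective _)
  obtain ⟨τ', hτ'⟩ := Module.projective_lifting_property q τ hq
  have hmem (y : C) : (LinearMap.id - τ ∘ₗ π : C →ₗ[R] C) y ∈ torsion R C := by
    refine (Quotient.mk_eq_zero _).1 ?_
    change π ((LinearMap.id - τ ∘ₗ π : C →ₗ[R] C) y) = 0
    have := LinearMap.congr_fun hτ (π y)
    simp only [LinearMap.comp_apply, LinearMap.id_apply] at this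
    simp only [LinearMap.sub_apply, LinearMap.id_apply, LinearMap.comp_apply, map_sub]
    exact sub_eq_zero.2 this.symm
  -- The element `y` splits as `τ (π y)` plus a torsion remainder. The first part is lifted by
  -- projectivity, the second by `t`.
  refine ⟨τ' ∘ₗ π + t ∘ₗ (LinearMap.id - τ ∘ₗ π).codRestrict _ hmem, ?_⟩
  ext y
  have h1 : q (τ' (π y)) = τ (π y) := LinearMap.congr_fun hτ' (π y)
  simp [h1, ht]

/-- Retractions of the steps of a filtration compose to retractions of the whole module. -/
theorem exists_retraction_of_step (hF : ∀ n, F (n + 1) ≤ F n) {N₀ : ℤ}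
    (h₀ : ∀ n ≤ N₀, F n = ⊤)
    (h : ∀ n, ∃ l : F n →ₗ[R] F (n + 1), l ∘ₗ inclusion (hF n) = LinearMap.id) (n : ℤ) :
    ∃ l : A →ₗ[R] F n, l ∘ₗ (F n).subtype = LinearMap.id := by
  have base (n : ℤ) (hn : n ≤ N₀) : ∃ l : A →ₗ[R] F n, l ∘ₗ (F n).subtype = LinearMap.id :=
    ⟨LinearMap.id.codRestrict _ fun x => by rw [h₀ n hn]; trivial, rfl⟩
  obtain hn | hn := le_total n N₀
  · exact base n hn
  induction n, hn using Int.leInduction with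
  | base => exact base N₀ le_rfl
  | succ n hn ih =>
    obtain ⟨l, hl⟩ := ih
    obtain ⟨l', hl'⟩ := h n
    refine ⟨l' ∘ₗ l, ?_⟩
    ext x
    have h1 := LinearMap.congr_fun hl (inclusion (hF n) x)
    have h2 := LinearMap.congr_fun hl' x
    simp only [LinearMap.comp_apply, subtype_apply, coe_inclusion, LinearMap.id_apply] at h1 h2 ⊢
    rw [h1, h2]

/-- Compatible sections of the graded pieces of a finite filtration identify the torsion of `A`
with the direct sum of the torsion of the graded pieces. -/
theorem nonempty_torsion_equiv_directSum (q : ∀ n, F n →ₗ[R] G n)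
    (hq : ∀ n (x : F n), q n x = 0 ↔ (x : A) ∈ F (n + 1)) (hF : Antitone F)
    {N₀ N₁ : ℤ} (h₀ : ∀ n ≤ N₀, F n = ⊤) (h₁ : ∀ n, N₁ ≤ n → F n = ⊥)
    (s : ∀ n, G n →ₗ[R] F n) (hs : ∀ n, q n ∘ₗ s n = LinearMap.id) :
    Nonempty (torsion R A ≃ₗ[R] ⨁ n, torsion R (G n)) := by
  have hs' (n : ℤ) (y : G n) : q n (s n y) = y := LinearMap.congr_fun (hs n) y
  let j (n : ℤ) : torsion R (G n) →ₗ[R] torsion R A := torsionMap ((F n).subtype ∘ₗ s n)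
  let Φ : (⨁ n, torsion R (G n)) →ₗ[R] torsion R A := DirectSum.toModule R ℤ _ j
  have hj (n : ℤ) (y) : Φ (DirectSum.lof R ℤ _ n y) = j n y := DirectSum.toModule_lof ..
  refine ⟨(LinearEquiv.ofBijective Φ ⟨?_, ?_⟩).symm⟩
  · rw [← LinearMap.ker_eq_bot, LinearMap.ker_eq_bot']
    intro y hy
    classical
    by_contra hne
    have hsupp : (DFinsupp.support y).Nonempty := by
      rwa [Finset.nonempty_iff_ne_empty, Ne, DFinsupp.support_eq_empty]
    set m := (DFinsupp.support y).min' hsupp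
    have hm : m ∈ DFinsupp.support y := Finset.min'_mem _ _
    have hsum : Φ y = ∑ n ∈ DFinsupp.support y, j n (y n) := by
      conv_lhs => rw [← DirectSum.sum_support_of y]
      rw [map_sum]
      exact Finset.sum_congr rfl fun n _ => hj n _
    have hval : (0 : A) = ∑ n ∈ DFinsupp.support y, (s n (y n) : A) := by
      have := congrArg Subtype.val (hsum.symm.trans hy)
      rw [AddSubmonoidClass.coe_finsetSum] at this
      exact this.symm
    rw [← Finset.add_sum_erase _ _ hm] at hval
    -- All terms beyond the lowest index `m` lie deeper in the filtration, so the lowest one does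
    -- too, and `q m` kills it.
    have hrest : ∑ n ∈ (DFinsupp.support y).erase m, (s n (y n) : A) ∈ F (m + 1) := by
      refine sum_mem fun n hn => hF ?_ (s n (y n)).2
      have h1 := Finset.min'_le _ _ (Finset.mem_of_mem_erase hn)
      have h2 := Finset.ne_of_mem_erase hn
      change m ≤ n at h1
      lia
    have hmF : (s m (y m) : A) ∈ F (m + 1) := by
      rw [eq_neg_of_add_eq_zero_left hval.symm]
      exact neg_mem hrest
    rw [← hq, hs'] at hmF
    exact (DFinsupp.mem_support_iff.1 hm) (Subtype.ext hmF)
  -- Here `k` bounds the steps left until the filtration vanishes; each step subtracts the section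
  -- applied to the leading class.
  · have key (k : ℕ) : ∀ n : ℤ, N₁ ≤ n + k → ∀ x : torsion R A, (x : A) ∈ F n →
        x ∈ LinearMap.range Φ := by
      induction k with
      | zero =>
        intro n hn x hx
        rw [h₁ n (by simpa using hn), mem_bot] at hx
        rw [show x = 0 from Subtype.ext hx]
        exact zero_mem _
      | succ k ih =>
        intro n hn x hx
        have hxF : (⟨x, hx⟩ : F n) ∈ torsion R (F n) :=
          mem_torsion_of_injective (F n).injective_subtype x.2
        set y : torsion R (G n) := torsionMap (q n) ⟨⟨x, hx⟩, hxF⟩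
        have hmem : ((x - j n y : torsion R A) : A) ∈ F (n + 1) := by
          have : q n (⟨x, hx⟩ - s n y) = 0 := by
            rw [map_sub, hs']
            exact sub_self _
          exact (hq _ _).1 this
        have := add_mem (ih (n + 1) (by push_cast at hn; lia) _ hmem) ⟨_, hj n y⟩
        rwa [sub_add_cancel] at this
    intro x
    exact key (N₁ - N₀).toNat N₀ (by lia) x (by rw [h₀ N₀ le_rfl]; trivial)

/-- The lengths of `Hom(X, T n)` add up to at most the length of `Hom(X, ⨁ T n)`. -/
theorem sum_length_linearMap_le_directSum {T : ℤ → Type*} [∀ n, AddCommGroup (T n)]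
    [∀ n, Module R (T n)] (X : Type*) [AddCommGroup X] [Module R X] (s : Finset ℤ) :
    ∑ n ∈ s, Module.length R (X →ₗ[R] T n) ≤ Module.length R (X →ₗ[R] ⨁ n, T n) := by
  rw [← Finset.sum_coe_sort s, ← Module.length_pi_of_fintype]
  let Φ : (∀ n : s, X →ₗ[R] T n) →ₗ[R] X →ₗ[R] ⨁ n, T n :=
    LinearMap.lsum R _ R fun n => LinearMap.compRight R (DirectSum.lof R ℤ T n)
  refine Module.length_le_of_injective Φ ?_
  rw [← LinearMap.ker_eq_bot, LinearMap.ker_eq_bot']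
  intro f hf
  ext n x
  have := congrArg (DirectSum.component R ℤ T n) (LinearMap.congr_fun hf x)
  simp only [Φ, LinearMap.lsum_apply, LinearMap.sum_apply, LinearMap.comp_apply,
    LinearMap.proj_apply, LinearMap.compRight_apply, map_sum, LinearMap.zero_apply,
    map_zero] at this
  rw [Finset.sum_eq_single n] at this
  · simpa [DirectSum.component.lof_self] using this
  · intro m _ hm
    rw [DirectSum.component.of, dif_neg]
    exact fun h => hm (Subtype.ext h)
  · simp

end Filtration

/-! ### The exact couple of a filtered spectrum -/

theorem LinearMap.apply_mem_torsion_of_baseChange_eq_zero {R : Type*} [CommRing R] {M N : Type*}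
    [AddCommGroup M] [AddCommGroup N] [Module R M] [Module R N] {f : M →ₗ[R] N}
    (h : f.baseChange (FractionRing R) = 0) (x : M) : f x ∈ Submodule.torsion R N := by
  have h1 : TensorProduct.mk R (FractionRing R) N 1 (f x) = 0 := by
    have := LinearMap.congr_fun h (1 ⊗ₜ[R] x)
    rwa [LinearMap.baseChange_tmul] at this
  obtain ⟨c, hc⟩ := (IsLocalizedModule.eq_zero_iff (nonZeroDivisors R) _).1 h1
  exact ⟨c, hc⟩

namespace FilteredSpectrum

open Prespectrum Submodule

variable (M : FilteredSpectrum.{u}) (R : Type v) [CommRing R] [M.LinearStructure R]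

theorem totLin_trLin {n m : ℤ} (h : n ≤ m) (i : ℤ) (y : M.πFil m i) :
    M.totLin R n i (M.trLin R h i y) = M.totLin R m i y := by
  change πMap (M.toTotal.app (.op n)) i (πMap (M.tr h) i y) = πMap (M.toTotal.app (.op m)) i y
  refine (πMap_comp _ _ i y).symm.trans ?_
  have : M.tr h ≫ M.toTotal.app (.op n) = M.toTotal.app (.op m) :=
    (M.toTotal.naturality (homOfLE h).op).trans (Category.comp_id _)
  rw [this]

theorem trLin_self (n i : ℤ) (h : n ≤ n) (y : M.πFil n i) : M.trLin R h i y = y := by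
  change πMap (M.tr h) i y = y
  have : M.tr h = 𝟙 _ := M.fil.map_id (.op n)
  rw [this]
  exact πMap_id _ _ _

theorem trLin_eq_zero_of_le {a b m : ℤ} (hab : a ≤ b) (hb : b ≤ m) {i : ℤ} {y : M.πFil m i}
    (hy : M.trLin R hb i y = 0) : M.trLin R (hab.trans hb) i y = 0 := by
  rw [← M.trLin_trLin R hab hb, hy, map_zero]

theorem exact_bdLin_trLin (n i : ℤ) :
    Function.Exact (M.bdLin R n i) (M.trLin R (by lia : n ≤ n + 1) (i - 1)) :=
  exact_πBoundary_πMap (M.tr (by lia : n ≤ n + 1)) i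

theorem exists_trLin_eq {n i : ℤ} {y : M.πFil n i} (hy : M.grLin R n i y = 0) :
    ∃ x, M.trLin R (by lia : n ≤ n + 1) i x = y :=
  exists_πMap_eq (M.isOmega_fil _) (M.isOmega_fil _) (M.tr (by lia : n ≤ n + 1)) i y hy

/-! ### Boundaries are torsion -/

/-- A class dying in `fil^p` becomes in `fil^{p+1}` the boundary of some `x` in `gr^p`, and
`d_{r+1}` sends the class of `x` to that of the image of `y`. As this differential is torsion, a
multiple of that image by a non-zero-divisor is a boundary of the previous stage, hence torsion by
`hB`. -/
theorem grLin_mem_torsion_of_trLin_eq_zero (hrat : M.DegeneratesRationally R) (r : ℕ) (p j : ℤ)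
    (hB : M.boundaries R r (p + 1 + r) (j - 1) ≤ torsion R _) (y : M.πFil (p + 1 + r) (j - 1))
    (hy : M.trLin R (by lia : p ≤ p + 1 + r) (j - 1) y = 0) :
    M.grLin R (p + 1 + r) (j - 1) y ∈ torsion R (M.πGr (p + 1 + r) (j - 1)) := by
  obtain ⟨x, hx⟩ := (M.exact_bdLin_trLin R p j
    (M.trLin R (by lia : p + 1 ≤ p + 1 + r) (j - 1) y)).1 (by rw [trLin_trLin]; exact hy)
  have hxc : x ∈ M.cycles R r p j := ⟨y, hx.symm⟩
  obtain ⟨c, hc⟩ := LinearMap.apply_mem_torsion_of_baseChange_eq_zero (hrat r p j)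
    (Submodule.Quotient.mk ⟨x, hxc⟩)
  have hd : M.differential R r p j (Submodule.Quotient.mk ⟨x, hxc⟩) =
      M.filToPage R r (p + 1 + r) (j - 1) y :=
    M.preDifferential_apply R r p j ⟨x, hxc⟩ y hx.symm
  rw [hd] at hc
  replace hc : M.filToPage R r (p + 1 + r) (j - 1) ((c : R) • y) = 0 :=
    (map_smul _ _ _).trans hc
  have hmem : (c : R) • M.grLin R (p + 1 + r) (j - 1) y ∈
      M.boundaries R r (p + 1 + r) (j - 1) := by
    rw [← map_smul]
    have := (Submodule.Quotient.mk_eq_zero _).1 hc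
    exact this
  exact mem_torsion_of_smul_mem c.2 (hB hmem)

theorem boundaries_le_torsion (hrat : M.DegeneratesRationally R) (r : ℕ) (n i : ℤ) :
    M.boundaries R r n i ≤ torsion R (M.πGr n i) := by
  induction r generalizing n i with
  | zero =>
    rintro _ ⟨y, hy, rfl⟩
    have := M.trLin_eq_zero_of_le R (by simp : n ≤ n - (0 : ℕ)) _ hy
    rw [trLin_self] at this
    rw [this, map_zero]
    exact zero_mem _
  | succ r ih =>
    -- The spot is rewritten as the target of the differential leaving `(p, j)`; then `n - (r + 1)`
    -- is `p`.
    obtain ⟨p, rfl⟩ : ∃ p, n = p + 1 + r := ⟨n - 1 - r, by ring⟩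
    obtain ⟨j, rfl⟩ : ∃ j, i = j - 1 := ⟨i + 1, by ring⟩
    rintro _ ⟨y, hy, rfl⟩
    exact M.grLin_mem_torsion_of_trLin_eq_zero R hrat r p j (ih _ _) y
      (M.trLin_eq_zero_of_le R (by push_cast; lia) _ hy)

theorem boundariesInf_le_torsion (hrat : M.DegeneratesRationally R) (n i : ℤ) :
    M.boundariesInf R n i ≤ torsion R (M.πGr n i) :=
  iSup_le fun r => M.boundaries_le_torsion R hrat r n i

theorem boundariesInf_le_cyclesInf (n i : ℤ) : M.boundariesInf R n i ≤ M.cyclesInf R n i := by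
  refine iSup_le fun r => le_iInf fun r' => ?_
  rintro _ ⟨y, -, rfl⟩
  exact M.grLin_mem_cycles R r' n i y

/-! ### The filtration of the homotopy groups -/

theorem F_antitone (i : ℤ) : Antitone fun n => M.F R n i := by
  rintro n m h _ ⟨y, rfl⟩
  exact ⟨M.trLin R h i y, M.totLin_trLin R h i y⟩

/-- Below all jumps the filtration is constant, and exhaustiveness identifies the constant value. -/
theorem exists_F_eq_top (hconv : M.ConvergesStrongly R) (hlf : M.IsLocallyFinite R) (i : ℤ) :
    ∃ N, ∀ n ≤ N, M.F R n i = ⊤ := by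
  obtain ⟨l, hl⟩ := (hlf i).bddBelow
  have hconst (k : ℕ) : M.F R (l - k) i = M.F R l i := by
    induction k with
    | zero => simp
    | succ k ih =>
      rw [← ih]
      by_contra hne
      have := hl (show M.F R (l - (k + 1 : ℕ)) i ≠ M.F R (l - (k + 1 : ℕ) + 1) i by
        rwa [show l - ((k + 1 : ℕ) : ℤ) + 1 = l - k by push_cast; ring])
      push_cast at this
      lia
  have hl' : M.F R l i = ⊤ := by
    rw [← top_le_iff, ← hconv.exhaustive i]
    refine iSup_le fun n => ?_
    rw [← hconst (l - n).toNat]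
    exact M.F_antitone R i (by lia)
  exact ⟨l, fun n hn => top_le_iff.1 (hl' ▸ M.F_antitone R i hn)⟩

theorem exists_F_eq_bot (hconv : M.ConvergesStrongly R) (hlf : M.IsLocallyFinite R) (i : ℤ) :
    ∃ N, ∀ n, N ≤ n → M.F R n i = ⊥ := by
  obtain ⟨l, hl⟩ := (hlf i).bddAbove
  -- The start is `l + 1` because a jump at `l` compares `F^l` with `F^{l+1}`.
  have hconst (k : ℕ) : M.F R (l + 1 + k) i = M.F R (l + 1) i := by
    induction k with
    | zero => simp
    | succ k ih =>
      rw [← ih]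
      by_contra hne
      have := hl (show M.F R (l + 1 + k) i ≠ M.F R (l + 1 + k + 1) i from fun h => hne (by
        rw [h]; congr 1; push_cast; ring))
      lia
  have hl' : M.F R (l + 1) i = ⊥ := by
    rw [← le_bot_iff, ← hconv.hausdorff i]
    refine le_iInf fun n => ?_
    rw [← hconst (n - (l + 1)).toNat]
    exact M.F_antitone R i (by lia)
  exact ⟨l + 1, fun n hn => le_bot_iff.1 (hl' ▸ M.F_antitone R i hn)⟩

/-! ### A criterion for degeneration -/

section Criterion

variable {M R}

/-- A class dying in `π_i(M)` dies in some `fil^p`, so its image in the graded piece is a boundary,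
hence zero, and exactness lifts it one step. The lift still dies in `π_i(M)`, which lets the
induction continue. -/
theorem exists_lift_of_boundariesInf_eq_bot (hB : ∀ n i, M.boundariesInf R n i = ⊥)
    (hexh : M.IsExhaustive) {i m m' : ℤ} (h : m ≤ m') (y : M.πFil m i)
    (hy : M.totLin R m i y = 0) :
    ∃ y', M.trLin R h i y' = y ∧ M.totLin R m' i y' = 0 := by
  induction m', h using Int.leInduction with
  | base => exact ⟨y, M.trLin_self R _ _ _ _, hy⟩
  | succ m' h ih =>
    obtain ⟨z, hz, hz0⟩ := ih
    obtain ⟨p, hp, hpz⟩ := hexh.2 m' i z hz0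
    have hmem : M.grLin R m' i z ∈ M.boundariesInf R m' i := by
      refine mem_iSup_of_mem (m' - p).toNat ⟨z, ?_, rfl⟩
      exact M.trLin_eq_zero_of_le R (by lia : m' - (m' - p).toNat ≤ p) hp hpz
    rw [hB, mem_bot] at hmem
    obtain ⟨w, hw⟩ := M.exists_trLin_eq R hmem
    refine ⟨w, ?_, ?_⟩
    · rw [← hz, ← hw, trLin_trLin]
    · rw [← hz0, ← hw, totLin_trLin]

theorem eq_zero_of_compatible (hcomplete : M.IsComplete) {i : ℤ} (x : ∀ n : ℤ, M.πFil n i)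
    (hx : ∀ n : ℤ, M.trLin R (by lia : n ≤ n + 1) i (x (n + 1)) = x n) (n : ℤ) : x n = 0 := by
  obtain ⟨z, hz⟩ := exists_πHoLim_lift M.fil i x hx
  have := hcomplete i
  rw [Subsingleton.elim z 0] at hz
  exact (hz n).symm.trans (map_zero _)

theorem isDegenerate_of_boundariesInf_eq_bot (hB : ∀ n i, M.boundariesInf R n i = ⊥)
    (hcomplete : M.IsComplete) (hexh : M.IsExhaustive) : M.IsDegenerate := by
  intro n i
  refine (injective_iff_map_eq_zero (M.totHom n i)).2 fun y hy => ?_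
  have lift {m m' : ℤ} (h : m ≤ m') (y : LinearMap.ker (M.totLin R m i)) :
      ∃ y' : LinearMap.ker (M.totLin R m' i), M.trLin R h i y' = y := by
    obtain ⟨y', h1, h2⟩ := exists_lift_of_boundariesInf_eq_bot hB hexh h y.1 y.2
    exact ⟨⟨y', h2⟩, h1⟩
  choose L hL using @lift
  let z (k : ℕ) : LinearMap.ker (M.totLin R (n + k) i) :=
    Nat.rec (L (by simp : n ≤ n + (0 : ℕ)) ⟨y, hy⟩)
      (fun k w => L (by push_cast; lia : n + (k : ℤ) ≤ n + (k + 1 : ℕ)) w) k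
  have hz0 : M.trLin R (by simp : n ≤ n + (0 : ℕ)) i (z 0).1 = y :=
    hL (by simp : n ≤ n + (0 : ℕ)) ⟨y, hy⟩
  have hz (k : ℕ) :
      M.trLin R (by push_cast; lia : n + (k : ℤ) ≤ n + (k + 1 : ℕ)) i (z (k + 1)).1 = (z k).1 :=
    hL (by push_cast; lia : n + (k : ℤ) ≤ n + (k + 1 : ℕ)) (z k)
  have hle (k k' : ℕ) (h : k ≤ k') :
      M.trLin R (by lia : n + (k : ℤ) ≤ n + k') i (z k').1 = (z k).1 := by
    induction k', h using Nat.le_induction with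
    | base => exact M.trLin_self R _ _ _ _
    | succ k' h ih => rw [← ih, ← hz k', trLin_trLin]
  -- The lifts exist only at indices `n + k`. The family is extended to all integers by pushing `z
  -- 0` down below `n`, where `toNat` returns `0`.
  let x (m : ℤ) : M.πFil m i := M.trLin R (by lia : m ≤ n + (m - n).toNat) i (z (m - n).toNat).1
  have hx (m : ℤ) : M.trLin R (by lia : m ≤ m + 1) i (x (m + 1)) = x m := by
    simp only [x]
    rw [trLin_trLin, ← hle (m - n).toNat (m + 1 - n).toNat (by lia), trLin_trLin]
  have h0 := eq_zero_of_compatible hcomplete x hx n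
  rw [← hz0, ← hle 0 (n - n).toNat (by lia), trLin_trLin]
  exact h0

end Criterion

/-! ### Degenerate filtered spectra -/

section Degenerate

variable {M} (hdeg : M.IsDegenerate)
include hdeg

theorem IsDegenerate.totLin_injective (n i : ℤ) : Function.Injective (M.totLin R n i) := hdeg n i

theorem IsDegenerate.trLin_injective {n m : ℤ} (h : n ≤ m) (i : ℤ) :
    Function.Injective (M.trLin R h i) := fun x y hxy =>
  hdeg.totLin_injective R m i (by rw [← M.totLin_trLin R h, hxy, M.totLin_trLin])

/-- Injective transition maps force all boundary maps of the exact couple to vanish. -/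
theorem IsDegenerate.cyclesInf_eq_top (n i : ℤ) : M.cyclesInf R n i = ⊤ := by
  rw [← top_le_iff]
  refine fun x _ => (mem_iInf _).2 fun r => ⟨0, ?_⟩
  refine (hdeg.trLin_injective R (by lia : n ≤ n + 1) (i - 1) ?_).symm
  rw [(M.exact_bdLin_trLin R n i).apply_apply_eq_zero, map_zero, map_zero]

theorem IsDegenerate.boundariesInf_eq_bot (n i : ℤ) : M.boundariesInf R n i = ⊥ := by
  rw [← le_bot_iff]
  refine iSup_le fun r => ?_
  rintro _ ⟨y, hy, rfl⟩
  have : y = 0 := hdeg.trLin_injective R _ i (hy.trans (map_zero _).symm)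
  rw [this, map_zero]
  exact zero_mem _

/-- For a degenerate filtered spectrum, `π_i(fil^n M)` is the submodule `F^n π_i(M)`. -/
noncomputable def IsDegenerate.filEquiv (n i : ℤ) : M.πFil n i ≃ₗ[R] M.F R n i :=
  LinearEquiv.ofInjective (M.totLin R n i) (hdeg.totLin_injective R n i)

/-- The projection `F^n π_i(M) → π_i(gr^n M)` of a degenerate filtered spectrum. -/
noncomputable def IsDegenerate.proj (n i : ℤ) : M.F R n i →ₗ[R] M.πGr n i :=
  M.grLin R n i ∘ₗ (hdeg.filEquiv R n i).symm.toLinearMap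

variable {R}

/-- With `Z_∞` everything and `B_∞ = 0`, the limit page is `π_i(gr^n M)` itself. This transports
`grIso` to the kernel and the surjectivity of `proj`. -/
theorem IsDegenerate.grLin_eq_iff (n i : ℤ) (y : M.πFil n i) (x : M.πGr n i) :
    M.grLin R n i y = x ↔ M.filToPageInf R n i y =
      Submodule.Quotient.mk ⟨x, by rw [hdeg.cyclesInf_eq_top R]; trivial⟩ := by
  refine Iff.trans ?_ (Submodule.Quotient.eq _).symm
  rw [mem_comap, hdeg.boundariesInf_eq_bot R, mem_bot, ← sub_eq_zero]
  rfl

theorem IsDegenerate.proj_eq_zero_iff (hconv : M.ConvergesStrongly R) (n i : ℤ)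
    (x : M.F R n i) : hdeg.proj R n i x = 0 ↔ (x : M.πTot i) ∈ M.F R (n + 1) i := by
  obtain ⟨y, rfl⟩ := (hdeg.filEquiv R n i).surjective x
  obtain ⟨e, he⟩ := hconv.grIso n i
  have h1 : hdeg.proj R n i (hdeg.filEquiv R n i y) = M.grLin R n i y := by
    simp [IsDegenerate.proj]
  have h2 : (Submodule.Quotient.mk ⟨0, by rw [hdeg.cyclesInf_eq_top R]; trivial⟩ :
    M.PageInf R n i) = 0 := (Submodule.Quotient.mk_eq_zero _).2 (zero_mem _)
  rw [h1, hdeg.grLin_eq_iff, h2, ← he, e.map_eq_zero_iff]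
  exact Submodule.Quotient.mk_eq_zero _

theorem IsDegenerate.proj_surjective (hconv : M.ConvergesStrongly R) (n i : ℤ) :
    Function.Surjective (hdeg.proj R n i) := by
  intro x
  obtain ⟨e, he⟩ := hconv.grIso n i
  obtain ⟨z, hz⟩ := e.surjective
    (Submodule.Quotient.mk ⟨x, by rw [hdeg.cyclesInf_eq_top R]; trivial⟩)
  obtain ⟨⟨_, y, rfl⟩, rfl⟩ := Submodule.Quotient.mk_surjective _ z
  refine ⟨hdeg.filEquiv R n i y, ?_⟩
  have h1 : hdeg.proj R n i (hdeg.filEquiv R n i y) = M.grLin R n i y := by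
    simp [IsDegenerate.proj]
  rw [h1, hdeg.grLin_eq_iff, ← hz, ← he]
  rfl

end Degenerate

/-! ### Saturation -/

section Saturation

variable {M R}

theorem mk_mem_range_totTf_iff (n i : ℤ) (x : M.πTot i) :
    (Submodule.Quotient.mk x : M.πTot i ⧸ torsion R (M.πTot i)) ∈
      LinearMap.range (M.totTf R n i) ↔ ∃ t ∈ torsion R (M.πTot i), x - t ∈ M.F R n i := by
  constructor
  · rintro ⟨z, hz⟩
    obtain ⟨y, rfl⟩ := Submodule.Quotient.mk_surjective _ z
    refine ⟨x - M.totLin R n i y, (Submodule.Quotient.eq _).1 hz.symm, y, ?_⟩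
    rw [sub_sub_cancel]
  · rintro ⟨t, ht, y, hy⟩
    refine ⟨Submodule.Quotient.mk y, (Submodule.Quotient.eq _).2 ?_⟩
    rw [hy, sub_sub_cancel_left]
    exact neg_mem ht

/-- The hypothesis `h` says that torsion classes of `π_i(M)/F^n` lift to torsion of `π_i(M)`. If `ϖ
b` agrees with `F^n` up to torsion killed by `c`, then `c ϖ b` lies in `F^n`, and `h` applies to
`b`. -/
theorem IsDegenerate.isSaturatedDegenerate [IsDomain R] {ϖ : R} (hϖ : ϖ ≠ 0)
    (hdeg : M.IsDegenerate)
    (h : ∀ (n i : ℤ) (x : M.πTot i) (c : R), c ∈ nonZeroDivisors R → c • x ∈ M.F R n i →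
      ∃ t ∈ torsion R (M.πTot i), x - t ∈ M.F R n i) : M.IsSaturatedDegenerate R ϖ := by
  refine ⟨hdeg, fun n i => ⟨?_, le_antisymm ?_ ?_⟩⟩
  · refine (injective_iff_map_eq_zero (M.totTf R n i)).2 fun z hz => ?_
    obtain ⟨y, rfl⟩ := Submodule.Quotient.mk_surjective _ z
    exact (Submodule.Quotient.mk_eq_zero _).2 (mem_torsion_of_injective
      (hdeg.totLin_injective R n i) ((Submodule.Quotient.mk_eq_zero _).1 hz))
  · rintro _ ⟨x, hx, rfl⟩
    exact ⟨smul_mem _ ϖ hx, x, trivial, rfl⟩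
  · rintro _ ⟨hx, b, -, rfl⟩
    obtain ⟨b, rfl⟩ := Submodule.Quotient.mk_surjective _ b
    refine ⟨_, ?_, rfl⟩
    change Submodule.Quotient.mk (ϖ • b) ∈ _ at hx
    obtain ⟨t, ⟨c, hc⟩, hbt⟩ := (mk_mem_range_totTf_iff n i _).1 hx
    have hct : (c : R) • t = 0 := hc
    refine (mk_mem_range_totTf_iff n i b).2 (h n i b (c * ϖ)
      (mul_mem c.2 (mem_nonZeroDivisors_of_ne_zero hϖ)) ?_)
    have := smul_mem _ (c : R) hbt
    rwa [smul_sub, hct, sub_zero, ← mul_smul] at this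

/-- Up to a unit `c` is a power of `ϖ`. Saturation strips off one factor at a time, `ϖ` being
cancellable in the torsion-free quotient. -/
theorem IsSaturatedDegenerate.exists_torsion_sub_mem [IsDomain R] [IsDiscreteValuationRing R]
    {ϖ : R} (hϖ : Irreducible ϖ) (h : M.IsSaturatedDegenerate R ϖ) (n i : ℤ) (x : M.πTot i)
    (c : R) (hc : c ≠ 0) (hx : c • x ∈ M.F R n i) :
    ∃ t ∈ torsion R (M.πTot i), x - t ∈ M.F R n i := by
  rw [← mk_mem_range_totTf_iff]
  set z : M.πTot i ⧸ torsion R (M.πTot i) := Submodule.Quotient.mk x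
  have hcz : c • z ∈ LinearMap.range (M.totTf R n i) :=
    (mk_mem_range_totTf_iff n i _).2 ⟨0, zero_mem _, by rwa [sub_zero]⟩
  obtain ⟨k, w, rfl⟩ := IsDiscreteValuationRing.eq_unit_mul_pow_irreducible hc hϖ
  rw [mul_smul] at hcz
  replace hcz : ϖ ^ k • z ∈ LinearMap.range (M.totTf R n i) := by
    have := smul_mem _ (↑w⁻¹ : R) hcz
    rwa [← mul_smul, Units.inv_mul, one_smul] at this
  clear hx hc
  induction k with
  | zero => rwa [pow_zero, one_smul] at hcz
  | succ k ih =>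
    refine ih ?_
    rw [pow_succ', mul_smul] at hcz
    obtain ⟨s, hs, hs'⟩ := (h.2 n i).2.ge ⟨hcz, _, trivial, rfl⟩
    rwa [← smul_right_injective _ hϖ.ne_zero hs']

end Saturation

/-! ### The two criteria -/

section Main

variable {M} {R}

theorem length_ringLinearMap (N : Type*) [AddCommGroup N] [Module R N] :
    Module.length R (R →ₗ[R] N) = Module.length R N :=
  (LinearMap.ringLmapEquivSelf R R N).length_eq

/-- As `B_∞` is torsion, passing from `Z_∞` to `E_∞` lowers the torsion length by exactly that of
`B_∞`, and the torsion of `Z_∞` embeds in that of `π_i(gr^n M)`. -/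
theorem length_comap_boundariesInf_add (hconv : M.ConvergesStrongly R)
    (hrat : M.DegeneratesRationally R) (n i : ℤ) :
    Module.length R ((M.boundariesInf R n i).comap (M.cyclesInf R n i).subtype) +
      Module.length R (torsion R (M.GrF R n i)) ≤ Module.length R (torsion R (M.πGr n i)) := by
  obtain ⟨e, -⟩ := hconv.grIso n i
  rw [(torsionEquiv e).length_eq, ← length_torsion_quotient]
  · exact Module.length_le_of_injective _
      (torsionMap_injective (M.cyclesInf R n i).injective_subtype)
  · exact fun x hx => mem_torsion_of_injective (M.cyclesInf R n i).injective_subtype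
      (M.boundariesInf_le_torsion R hrat n i hx)

theorem IsSplitDegenerate.nonempty_torsion_equiv
    (hconv : M.ConvergesStrongly R) (hlf : M.IsLocallyFinite R) (h : M.IsSplitDegenerate R)
    (i : ℤ) : Nonempty (torsion R (M.πTot i) ≃ₗ[R] ⨁ n, torsion R (M.πGr n i)) := by
  obtain ⟨N₀, h₀⟩ := M.exists_F_eq_top R hconv hlf i
  obtain ⟨N₁, h₁⟩ := M.exists_F_eq_bot R hconv hlf i
  have hF (n : ℤ) : M.F R (n + 1) i ≤ M.F R n i := M.F_antitone R i (by lia)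
  have hq := fun n => h.1.proj_eq_zero_iff hconv n i
  -- A retraction of `π_i(M)` onto `F^{n+1}` restricts to `F^n`, and the splitting lemma turns it
  -- into a section of the projection.
  have hs (n : ℤ) : ∃ s, h.1.proj R n i ∘ₗ s = LinearMap.id := by
    refine ((exact_inclusion_of_ker (F := fun n => M.F R n i) hF (fun n => h.1.proj R n i) hq
      n).split_tfae (inclusion_injective (hF n)) (h.1.proj_surjective hconv n i)).out 0 1 |>.2 ?_
    obtain ⟨s, hs⟩ := h.2 (n + 1) i
    refine ⟨(h.1.filEquiv R (n + 1) i).toLinearMap ∘ₗ s ∘ₗ (M.F R n i).subtype, ?_⟩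
    ext ⟨_, y, rfl⟩
    exact congrArg (M.totLin R (n + 1) i) (LinearMap.congr_fun hs y)
  choose s hs using hs
  exact nonempty_torsion_equiv_directSum (F := fun n => M.F R n i) _ hq (M.F_antitone R i) h₀ h₁
    s hs

variable [IsDomain R] [IsDiscreteValuationRing R]

theorem isSaturatedDegenerate_of_sum_le {ϖ : R} (hϖ : Irreducible ϖ)
    (hcomplete : M.IsComplete) (hexhaustive : M.IsExhaustive)
    (hconv : M.ConvergesStrongly R) (hlf : M.IsLocallyFinite R)
    (hfg : M.HasFiniteHomotopy R) (hrat : M.DegeneratesRationally R)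
    (h : ∀ (i : ℤ) (s : Finset ℤ), ∑ n ∈ s, Module.length R (torsion R (M.πGr n i)) ≤
      Module.length R (torsion R (M.πTot i))) : M.IsSaturatedDegenerate R ϖ := by
  have := hfg.tot
  have hF (i n : ℤ) : M.F R (n + 1) i ≤ M.F R n i := M.F_antitone R i (by lia)
  choose N₀ h₀ using M.exists_F_eq_top R hconv hlf
  choose N₁ h₁ using M.exists_F_eq_bot R hconv hlf
  have hq (i n : ℤ) (x : M.F R n i) :
      ((M.F R (n + 1) i).comap (M.F R n i).subtype).mkQ x = 0 ↔ (x : M.πTot i) ∈ M.F R (n + 1) i :=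
    Submodule.Quotient.mk_eq_zero _
  have hlen := length_comap_boundariesInf_add hconv hrat
  -- The count is run with `X = R`, so that `Hom(X, -)` is the identity. Degeneration is not yet
  -- known, so the graded pieces are the `GrF`, while the bound `g` is the larger torsion length of
  -- `π_i(gr^n M)`.
  have key (i n : ℤ) := exists_torsion_lift_of_sum_le (F := fun n => M.F R n i) (hF i)
    (fun n => ((M.F R (n + 1) i).comap (M.F R n i).subtype).mkQ) (hq i) (h₀ i) (h₁ i) R
    (fun n => Module.length R (torsion R (M.πGr n i)))
    (fun n => by rw [length_ringLinearMap]; exact le_add_self.trans (hlen n i))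
    (fun s => by rw [length_ringLinearMap]; exact h i s) n
  have hB (n i : ℤ) : M.boundariesInf R n i = ⊥ := by
    have h1 := (key i n).1
    rw [length_ringLinearMap] at h1
    have hfin : Module.length R (torsion R (M.GrF R n i)) ≠ ⊤ := Module.length_torsion_ne_top
    -- Equality of the two torsion lengths leaves no room for `B_∞`: its length is zero.
    have h2 := (ENat.add_le_add_iff_right hfin).1
      (((hlen n i).trans h1).trans (zero_add _).ge)
    rw [nonpos_iff_eq_zero, Module.length_eq_zero_iff, subsingleton_iff_eq_bot] at h2
    rw [eq_bot_iff]
    intro x hx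
    have : (⟨x, M.boundariesInf_le_cyclesInf R n i hx⟩ : M.cyclesInf R n i) ∈
      (M.boundariesInf R n i).comap (M.cyclesInf R n i).subtype := hx
    rw [h2, mem_bot] at this
    exact congrArg Subtype.val this
  refine (isDegenerate_of_boundariesInf_eq_bot hB hcomplete hexhaustive).isSaturatedDegenerate
    hϖ.ne_zero fun n i x c hc hx => ?_
  refine _root_.exists_torsion_sub_mem (F := fun n => M.F R n i) _ (hq i) (M.F_antitone R i)
    (h₀ i) (fun n y => ?_) n x c hc hx
  obtain ⟨ψ, hψ⟩ := (key i n).2 (LinearMap.toSpanSingleton R _ y)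
  refine ⟨ψ 1, ?_⟩
  have := LinearMap.congr_fun hψ 1
  rwa [LinearMap.toSpanSingleton_apply, one_smul] at this

/-- A torsion class of `π_i(gr^n M)` comes from some `x` in `F^n` with a nonzero multiple in
`F^{n+1}`. Saturation replaces `x` by a torsion element modulo `F^{n+1}`, so torsion is exact along
the filtration. -/
theorem IsSaturatedDegenerate.length_torsion_eq {ϖ : R} (hϖ : Irreducible ϖ)
    (hconv : M.ConvergesStrongly R) (hlf : M.IsLocallyFinite R)
    (h : M.IsSaturatedDegenerate R ϖ) (i : ℤ) :
    Module.length R (torsion R (M.πTot i)) =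
      ⨆ s : Finset ℤ, ∑ n ∈ s, Module.length R (torsion R (M.πGr n i)) := by
  obtain ⟨N₀, h₀⟩ := M.exists_F_eq_top R hconv hlf i
  obtain ⟨N₁, h₁⟩ := M.exists_F_eq_bot R hconv hlf i
  have hq := fun n => h.1.proj_eq_zero_iff hconv n i
  refine length_torsion_eq_iSup_sum (F := fun n => M.F R n i)
    (fun n => M.F_antitone R i (by lia)) (fun n => h.1.proj R n i) hq h₀ h₁ ?_
  rintro n ⟨y, c, hc⟩
  obtain ⟨x, rfl⟩ := h.1.proj_surjective hconv n i y
  rw [Submonoid.smul_def, ← map_smul, hq] at hc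
  obtain ⟨t, ht, hxt⟩ := h.exists_torsion_sub_mem hϖ (n + 1) i x c (nonZeroDivisors.ne_zero c.2) hc
  have htF : t ∈ M.F R n i := by
    have := sub_mem x.2 (M.F_antitone R i (by lia : n ≤ n + 1) hxt)
    rwa [sub_sub_cancel] at this
  refine ⟨⟨⟨t, htF⟩, mem_torsion_of_injective (M.F R n i).injective_subtype ht⟩, Subtype.ext ?_⟩
  change h.1.proj R n i ⟨t, htF⟩ = h.1.proj R n i x
  rw [eq_comm, ← sub_eq_zero, ← map_sub, hq]
  exact hxt

theorem isSplitDegenerate_of_torsion_equiv {ϖ : R} (hϖ : Irreducible ϖ)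
    (hcomplete : M.IsComplete) (hexhaustive : M.IsExhaustive)
    (hconv : M.ConvergesStrongly R) (hlf : M.IsLocallyFinite R)
    (hfg : M.HasFiniteHomotopy R) (hrat : M.DegeneratesRationally R)
    (h : ∀ i, Nonempty (torsion R (M.πTot i) ≃ₗ[R] ⨁ n, torsion R (M.πGr n i))) :
    M.IsSplitDegenerate R := by
  have := hfg.tot
  have := hfg.gr
  have hsum (X : Type _) [AddCommGroup X] [Module R X] (i : ℤ) (s : Finset ℤ) :
      ∑ n ∈ s, Module.length R (X →ₗ[R] torsion R (M.πGr n i)) ≤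
        Module.length R (X →ₗ[R] torsion R (M.πTot i)) := by
    obtain ⟨e⟩ := h i
    rw [LinearEquiv.length_eq (N := X →ₗ[R] ⨁ n, torsion R (M.πGr n i)) (LinearEquiv.congrRight e)]
    exact sum_length_linearMap_le_directSum X s
  have hsum' (i : ℤ) (s : Finset ℤ) : ∑ n ∈ s, Module.length R (torsion R (M.πGr n i)) ≤
      Module.length R (torsion R (M.πTot i)) := by
    obtain ⟨e⟩ := h i
    have := sum_length_linearMap_le_directSum (R := R) (T := fun n => torsion R (M.πGr n i)) R s
    simp only [length_ringLinearMap] at this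
    rwa [e.length_eq]
  have hdeg : M.IsDegenerate := (isSaturatedDegenerate_of_sum_le hϖ hcomplete hexhaustive hconv hlf
    hfg hrat hsum').1
  refine ⟨hdeg, fun n i => ?_⟩
  obtain ⟨N₀, h₀⟩ := M.exists_F_eq_top R hconv hlf i
  obtain ⟨N₁, h₁⟩ := M.exists_F_eq_bot R hconv hlf i
  have hF (n : ℤ) : M.F R (n + 1) i ≤ M.F R n i := M.F_antitone R i (by lia)
  have hq := fun n => hdeg.proj_eq_zero_iff hconv n i
  obtain ⟨l, hl⟩ := exists_retraction_of_step (F := fun n => M.F R n i) hF h₀ (fun n => by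
    refine ((exact_inclusion_of_ker (F := fun n => M.F R n i) hF (fun n => hdeg.proj R n i) hq
      n).split_tfae (inclusion_injective (hF n)) (hdeg.proj_surjective hconv n i)).out 0 1 |>.1 ?_
    -- Taking `X` to be the torsion of `π_i(gr^n M)`, the lift of its identity map is a section on
    -- torsion, which extends over the free quotient.
    obtain ⟨ψ, hψ⟩ := (exists_torsion_lift_of_sum_le (F := fun n => M.F R n i) hF
      (fun n => hdeg.proj R n i) hq h₀ h₁ (torsion R (M.πGr n i)) _ (fun _ => le_rfl)
      (hsum _ i) n).2 LinearMap.id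
    exact exists_section_of_torsion_section _ (hdeg.proj_surjective hconv n i)
      ((torsion R (M.F R n i)).subtype ∘ₗ ψ)
      fun x => congrArg Subtype.val (LinearMap.congr_fun hψ x)) n
  refine ⟨(hdeg.filEquiv R n i).symm.toLinearMap ∘ₗ l, ?_⟩
  ext y
  have := LinearMap.congr_fun hl (hdeg.filEquiv R n i y)
  exact (LinearEquiv.symm_apply_eq (hdeg.filEquiv R n i)).2 this

end Main

end FilteredSpectrum

theorem mainTheorem9
    {R : Type*} [CommRing R] [IsDomain R] [IsDiscreteValuationRing R]
    (ϖ : R) (hϖ : Irreducible ϖ)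
    (M : FilteredSpectrum) [M.LinearStructure R]
    (hcomplete : M.IsComplete) (hexhaustive : M.IsExhaustive)
    (hconv : M.ConvergesStrongly R) (hlf : M.IsLocallyFinite R)
    (hfg : M.HasFiniteHomotopy R)
    (hrat : M.DegeneratesRationally R) :
    (M.IsSaturatedDegenerate R ϖ ↔
      ∀ i : ℤ, Module.length R (Submodule.torsion R (M.πTot i)) =
        ⨆ s : Finset ℤ, ∑ n ∈ s, Module.length R (Submodule.torsion R (M.πGr n i))) ∧
    (M.IsSplitDegenerate R ↔
      ∀ i : ℤ, Nonempty (Submodule.torsion R (M.πTot i) ≃ₗ[R]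
        ⨁ n : ℤ, Submodule.torsion R (M.πGr n i))) :=
  ⟨⟨fun h i => h.length_torsion_eq hϖ hconv hlf i, fun h =>
    FilteredSpectrum.isSaturatedDegenerate_of_sum_le hϖ hcomplete hexhaustive hconv hlf hfg hrat
      fun i s => (h i).symm ▸
        le_iSup (fun s : Finset ℤ => ∑ n ∈ s, Module.length R (Submodule.torsion R (M.πGr n i))) s⟩,
    ⟨fun h i => h.nonempty_torsion_equiv hconv hlf i, fun h =>
      FilteredSpectrum.isSplitDegenerate_of_torsion_equiv hϖ hcomplete hexhaustive hconv hlf hfg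
        hrat h⟩⟩
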